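/- Let $p_1=0$, $p_2=1$, $p_3=e^{\pi\sqrt{-1}/3}$, let $F_i(x)=\frac12(x-p_i)+p_i$ on $\mathbb{R}^2\cong\mathbb{C}$, and let $K$ be the Sierpiński gasket, i.e. the unique nonempty compact set with $K=F_1(K)\cup F_2(K)\cup F_3(K)$. Put $V_0=\{p_1,p_2,p_3\}$, let $\mu$ be the normalized $\frac{\log 3}{\log 2}$-dimensional Hausdorff measure on $K$, and for a word $\omega=\omega_1\cdots\omega_n\in\{1,2,3\}^n$ put $F_\omega=F_{\omega_1}\circ\cdots\circ F_{\omega_n}$. For real numbers $a>b>0$ (initial conductances $(a,b,c)$ with $c=b$), let $(x_n,y_n,z_n)_{n\ge0}$ be the unique sequence of triples of positive numbers with $x_0=\frac{a}{\eta}$, $y_0=\frac b\eta$, $z_0=\frac c\eta$, $\eta=ab+bc+ca$, and, for all $n\ge1$, $$x_{n-1}=x_n+\phi(x_n;y_n,z_n),\quad y_{n-1}=y_n+\phi(y_n;z_n,x_n),\quad z_{n-1}=z_n+\phi(z_n;x_n,y_n),$$ where $\phi(x;y,z)=\frac{(x+y)(x+z)}{2(x+y+z)}$; then $y_n=z_n$.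 Let $a_n=x_n/r_n$ and $b_n=y_n/r_n$ with $r_n=x_ny_n+y_nz_n+z_nx_n$, so that $a_0=a$, $b_0=b$. For $u\in C(K)$ put $u_\omega=u\circ F_\omega$, $$\mathcal{E}^{(a,b)}_n(u)=\sum_{\omega\in\{1,2,3\}^n}\Big(b_n\big(u_\omega(p_1)-u_\omega(p_2)\big)^2+b_n\big(u_\omega(p_1)-u_\omega(p_3)\big)^2+a_n\big(u_\omega(p_2)-u_\omega(p_3)\big)^2\Big),$$ $\mathcal{E}^{(a,b)}(u)=\lim_{n\to\infty}\mathcal{E}^{(a,b)}_n(u)$, $\mathcal{F}=\{u\in C(K):\mathcal{E}^{(a,b)}(u)<\infty\}$, and $\mathcal{F}_0=\{u\in\mathcal{F}:u|_{V_0}=0\}$; write $\mathcal{E}^{(a,b)}(u,v)$ for the associated bilinear form. The operator $-\Delta^{(a,b)}$ with the Dirichlet boundary condition is defined by: $u$ is in its domain and $-\Delta^{(a,b)}u=f\in L^2(K,\mu)$ if and only if $u\in\mathcal{F}_0$ and $\mathcal{E}^{(a,b)}(u,v)=\int_K fv\,d\mu$ for all $v\in\mathcal{F}_0$. **Lemma.**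 There exists a constant $C>0$ such that for all initial data $a>b=c>0$, the operator $-\Delta^{(a,b)}$ with the Dirichlet boundary condition has a smallest eigenvalue $\lambda_1^{(a,b)}$, and $$C^{-1}b\le\lambda_1^{(a,b)}\le Cb.$$ -/

import Mathlib

open Filter Topology MeasureTheory Measure TopologicalSpace

noncomputable section

namespace SG

/-! ### The Sierpinski gasket -/

/-- The three boundary points `p₁ = 0`, `p₂ = 1`, `p₃ = exp(π √-1 / 3)`, indexed by `0, 1, 2`. -/
def vertex : Fin 3 → ℂ := ![0, 1, Complex.exp (Real.pi * Complex.I / 3)]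

/-- The maps `F_i(x) = (x - p_i) / 2 + p_i` of the iterated function system. -/
def ifs (i : Fin 3) (x : ℂ) : ℂ := (1 / 2 : ℂ) * (x - vertex i) + vertex i

theorem ifs_vertex (i : Fin 3) : ifs i (vertex i) = vertex i := by simp [ifs]

theorem edist_ifs (i : Fin 3) (x y : ℂ) : edist (ifs i x) (ifs i y) = 2⁻¹ * edist x y := by
  have h : ifs i x - ifs i y = (1 / 2 : ℂ) * (x - y) := by simp only [ifs]; ring
  rw [edist_eq_enorm_sub, edist_eq_enorm_sub, h, enorm_mul]
  congr 1
  rw [one_div, enorm_inv (by norm_num)]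
  congr 1
  rw [← ofReal_norm]
  simp

theorem continuous_ifs (i : Fin 3) : Continuous (ifs i) := by
  unfold ifs; fun_prop

/-- The operator `K ↦ F₁(K) ∪ F₂(K) ∪ F₃(K)` on nonempty compact subsets of the plane. -/
def hutchinson (K : NonemptyCompacts ℂ) : NonemptyCompacts ℂ where
  carrier := ⋃ i, ifs i '' (K : Set ℂ)
  isCompact' := isCompact_iUnion fun i => K.isCompact.image (continuous_ifs i)
  nonempty' := by
    obtain ⟨x, hx⟩ := K.nonempty
    exact ⟨ifs 0 x, Set.mem_iUnion.2 ⟨0, x, hx, rfl⟩⟩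

theorem contracting_hutchinson : ContractingWith 2⁻¹ hutchinson := by
  refine ⟨by rw [← NNReal.coe_lt_coe]; norm_num, fun K L => ?_⟩
  change Metric.hausdorffEDist (⋃ i, ifs i '' (K : Set ℂ)) (⋃ i, ifs i '' (L : Set ℂ)) ≤
    ((2⁻¹ : NNReal) : ENNReal) * Metric.hausdorffEDist (K : Set ℂ) (L : Set ℂ)
  have hc : ((2⁻¹ : NNReal) : ENNReal) = 2⁻¹ := by
    rw [ENNReal.coe_inv (by norm_num)]; rfl
  have key : ∀ (A B : NonemptyCompacts ℂ) (i : Fin 3), ∀ x ∈ ifs i '' (A : Set ℂ),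
      ∃ y ∈ ifs i '' (B : Set ℂ),
        edist x y ≤ 2⁻¹ * Metric.hausdorffEDist (A : Set ℂ) (B : Set ℂ) := by
    rintro A B i _ ⟨x, hx, rfl⟩
    obtain ⟨y, hy, hxy⟩ := B.isCompact.exists_infEDist_eq_edist B.nonempty x
    refine ⟨ifs i y, ⟨y, hy, rfl⟩, ?_⟩
    rw [edist_ifs, ← hxy]
    gcongr
    exact Metric.infEDist_le_hausdorffEDist_of_mem hx
  rw [hc]
  refine Metric.hausdorffEDist_iUnion_le.trans (iSup_le fun i => ?_)
  refine Metric.hausdorffEDist_le_of_mem_edist (key K L i) ?_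
  rw [Metric.hausdorffEDist_comm]
  exact key L K i

theorem existsUnique_gasket :
    ∃! K : NonemptyCompacts ℂ, (K : Set ℂ) = ⋃ i, ifs i '' (K : Set ℂ) := by
  have : Nonempty (NonemptyCompacts ℂ) := ⟨{0}⟩
  have hiff : ∀ K : NonemptyCompacts ℂ, (K : Set ℂ) = ⋃ i, ifs i '' (K : Set ℂ) ↔
      Function.IsFixedPt hutchinson K := fun K =>
    ⟨fun h => SetLike.coe_injective h.symm, fun h => (congrArg SetLike.coe h).symm⟩
  refine ⟨ContractingWith.fixedPoint hutchinson contracting_hutchinson,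
    (hiff _).2 contracting_hutchinson.fixedPoint_isFixedPt, fun K hK => ?_⟩
  exact contracting_hutchinson.fixedPoint_unique ((hiff K).1 hK)

/-- The Sierpinski gasket `K`: the unique nonempty compact subset of the plane such that
`K = F₁(K) ∪ F₂(K) ∪ F₃(K)`. -/
def gasket : NonemptyCompacts ℂ := existsUnique_gasket.choose

theorem gasket_eq : (gasket : Set ℂ) = ⋃ i, ifs i '' (gasket : Set ℂ) :=
  existsUnique_gasket.choose_spec.1

theorem ifs_mem_gasket (i : Fin 3) {x : ℂ} (hx : x ∈ gasket) : ifs i x ∈ gasket := by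
  have h : ifs i x ∈ ⋃ i, ifs i '' (gasket : Set ℂ) := Set.mem_iUnion.2 ⟨i, x, hx, rfl⟩
  rw [← gasket_eq] at h
  exact h

theorem vertex_mem_gasket (i : Fin 3) : vertex i ∈ gasket := by
  obtain ⟨x, hx⟩ := gasket.nonempty
  have hmem : ∀ n : ℕ, (ifs i)^[n] x ∈ gasket := by
    intro n
    induction n with
    | zero => exact hx
    | succ k ih => rw [Function.iterate_succ_apply']; exact ifs_mem_gasket i ih
  have hform : ∀ n : ℕ, (ifs i)^[n] x = (1 / 2 : ℂ) ^ n * (x - vertex i) + vertex i := by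
    intro n
    induction n with
    | zero => simp
    | succ k ih => rw [Function.iterate_succ_apply', ih]; simp only [ifs]; ring
  have hlim : Tendsto (fun n : ℕ => (ifs i)^[n] x) atTop (𝓝 (vertex i)) := by
    have h0 : Tendsto (fun n : ℕ => (1 / 2 : ℂ) ^ n) atTop (𝓝 0) :=
      tendsto_pow_atTop_nhds_zero_of_norm_lt_one (by norm_num)
    have h1 := (h0.mul_const (x - vertex i)).add_const (vertex i)
    simp only [zero_mul, zero_add] at h1
    exact h1.congr fun n => (hform n).symm
  exact gasket.isCompact.isClosed.mem_of_tendsto hlim (Eventually.of_forall hmem)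

/-- The boundary points `p_i`, as points of `K`. -/
def bdry (i : Fin 3) : gasket := ⟨vertex i, vertex_mem_gasket i⟩

/-- The maps `F_i`, as maps of `K` into itself. -/
def cell (i : Fin 3) (x : gasket) : gasket := ⟨ifs i x, ifs_mem_gasket i x.2⟩

/-- `F_ω = F_{ω₁} ∘ ⋯ ∘ F_{ωₙ}` for a word `ω` of length `n`. -/
def wordMap : (n : ℕ) → (Fin n → Fin 3) → gasket → gasket
  | 0, _, x => x
  | n + 1, w, x => cell (w 0) (wordMap n (Fin.tail w) x)

/-- The normalized `α`-dimensional Hausdorff measure on `K`, `α = log 3 / log 2`. -/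
def mu : Measure gasket :=
  ((μH[Real.log 3 / Real.log 2] : Measure gasket) Set.univ)⁻¹ •
    (μH[Real.log 3 / Real.log 2] : Measure gasket)

/-! ### The recursive construction of conductances -/

/-- `φ(x; y, z) = (x + y) (x + z) / (2 (x + y + z))`. -/
def phi (x y z : ℝ) : ℝ := (x + y) * (x + z) / (2 * (x + y + z))

/-- A sequence of resistances `(x_n, y_n, z_n)`, `n ≥ 0`, of `Y`-shaped networks is compatible if
all of them are positive and the network of level `n` reduces to that of level `n - 1`. -/
structure IsCompatible (x y z : ℕ → ℝ) : Prop where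
  pos : ∀ n, 0 < x n ∧ 0 < y n ∧ 0 < z n
  eqx : ∀ n, x n = x (n + 1) + phi (x (n + 1)) (y (n + 1)) (z (n + 1))
  eqy : ∀ n, y n = y (n + 1) + phi (y (n + 1)) (z (n + 1)) (x (n + 1))
  eqz : ∀ n, z n = z (n + 1) + phi (z (n + 1)) (x (n + 1)) (y (n + 1))

/-- The resistances `(x_n, y_n)` (and `z_n = y_n`) of the `Y`-shaped networks obtained from the
conductances `(a, b, b)` at level `0`: the `Δ-Y` transform `x₀ = a / η`, `y₀ = b / η`,
`η = ab + b² + ba`, followed by solving the compatibility equations level by level. The theorem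
`isCompatible_iff` says that these are the only compatible resistances with this
initial value. -/
def resist (a b : ℝ) : ℕ → ℝ × ℝ
  | 0 => (a / (a * b + b * b + b * a), b / (a * b + b * b + b * a))
  | n + 1 =>
    let x := (resist a b n).1
    let y := (resist a b n).2
    ((14 * x + 3 * y - 2 * √(4 * x ^ 2 + 6 * x * y + 6 * y ^ 2)) / 15,
      (-2 * x + y + √(4 * x ^ 2 + 6 * x * y + 6 * y ^ 2)) / 5)

theorem step_solves {x y : ℝ} (hy : 0 < y) (hxy : y ≤ x) :
    let x' := (14 * x + 3 * y - 2 * √(4 * x ^ 2 + 6 * x * y + 6 * y ^ 2)) / 15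
    let y' := (-2 * x + y + √(4 * x ^ 2 + 6 * x * y + 6 * y ^ 2)) / 5
    0 < y' ∧ y' ≤ x' ∧ x = x' + phi x' y' y' ∧ y = y' + phi y' y' x' ∧ y = y' + phi y' x' y' := by
  intro x' y'
  have hx : 0 < x := hy.trans_le hxy
  have hxyp : 0 < x * y := mul_pos hx hy
  obtain ⟨s, hs⟩ : ∃ s, s = √(4 * x ^ 2 + 6 * x * y + 6 * y ^ 2) := ⟨_, rfl⟩
  have hs0 : 0 ≤ s := hs ▸ Real.sqrt_nonneg _
  have hs2 : s ^ 2 = 4 * x ^ 2 + 6 * x * y + 6 * y ^ 2 := by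
    rw [hs, Real.sq_sqrt (by positivity)]
  have hx' : x' = (14 * x + 3 * y - 2 * s) / 15 := by rw [hs]
  have hy' : y' = (-2 * x + y + s) / 5 := by rw [hs]
  clear_value x' y'
  clear hs
  have h1 : 2 * x - y < s := by nlinarith
  have h2 : s ≤ 4 * x := by nlinarith
  have hyp : 0 < y' := by rw [hy']; linarith
  have hle : y' ≤ x' := by rw [hx', hy']; linarith
  have hlin : 2 * x + y = 3 * x' + 2 * y' := by rw [hx', hy']; ring
  have hq : y * (x' + 2 * y') = y' * (2 * x' + 3 * y') := by
    rw [hx', hy']; nlinarith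
  have hxp : 0 < x' := hyp.trans_le hle
  have hd : x' + 2 * y' ≠ 0 := by positivity
  have hyeq : y = y' * (2 * x' + 3 * y') / (x' + 2 * y') := by rw [eq_div_iff hd]; exact hq
  have hxeq : x = (3 * x' + 2 * y' - y) / 2 := by linarith
  refine ⟨hyp, hle, ?_, ?_, ?_⟩
  · rw [hxeq, hyeq, phi]
    have hd' : 2 * (x' + y' + y') ≠ 0 := by positivity
    field_simp
    ring
  · rw [hyeq, phi]
    have hd' : 2 * (y' + y' + x') ≠ 0 := by positivity
    have : 2 * (y' + y' + x') = 2 * (x' + 2 * y') := by ring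
    rw [this]
    field_simp
    ring
  · rw [hyeq, phi]
    have hd' : 2 * (y' + x' + y') ≠ 0 := by positivity
    have : 2 * (y' + x' + y') = 2 * (x' + 2 * y') := by ring
    rw [this]
    field_simp
    ring

theorem resist_pos {a b : ℝ} (hb : 0 < b) (hab : b ≤ a) (n : ℕ) :
    0 < (resist a b n).2 ∧ (resist a b n).2 ≤ (resist a b n).1 := by
  induction n with
  | zero =>
    have ha : 0 < a := hb.trans_le hab
    simp only [resist]
    constructor
    · positivity
    · gcongr
  | succ k ih =>
    have := step_solves ih.1 ih.2
    exact ⟨this.1, this.2.1⟩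

theorem step_unique {x y z x' y' : ℝ} (hx : 0 < x) (hy : 0 < y) (hz : 0 < z)
    (h1 : x' = x + phi x y z) (h2 : y' = y + phi y z x) (h3 : y' = z + phi z x y) :
    x = (14 * x' + 3 * y' - 2 * √(4 * x' ^ 2 + 6 * x' * y' + 6 * y' ^ 2)) / 15 ∧
    y = (-2 * x' + y' + √(4 * x' ^ 2 + 6 * x' * y' + 6 * y' ^ 2)) / 5 ∧ z = y := by
  have hzy : z = y := by
    have h4 : y + phi y z x = z + phi z x y := h2.symm.trans h3
    simp only [phi] at h4
    have e1 : y + z + x = x + y + z := by ring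
    have e2 : z + x + y = x + y + z := by ring
    rw [e1, e2] at h4
    have hd : 0 < 2 * (x + y + z) := by positivity
    field_simp at h4
    have h5 : (z - y) * (2 * (x + y + z) + (y + z)) = 0 := by linarith
    rcases mul_eq_zero.1 h5 with h | h
    · linarith
    · nlinarith
  subst hzy
  have hd : 0 < x + 2 * z := by positivity
  have hxe : x' = (3 * x ^ 2 + 6 * x * z + z ^ 2) / (2 * (x + 2 * z)) := by
    rw [h1, phi]
    have : x + z + z = x + 2 * z := by ring
    rw [this]; field_simp; ring
  have hye : y' = z * (2 * x + 3 * z) / (x + 2 * z) := by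
    rw [h2, phi]
    have : z + z + x = x + 2 * z := by ring
    rw [this]; field_simp; ring
  have hs : √(4 * x' ^ 2 + 6 * x' * y' + 6 * y' ^ 2) = 5 * z + 2 * x' - y' := by
    rw [Real.sqrt_eq_iff_mul_self_eq_of_pos]
    · rw [hxe, hye]; field_simp; ring
    · have : 5 * z + 2 * x' - y' = (3 * x ^ 2 + 9 * x * z + 8 * z ^ 2) / (x + 2 * z) := by
        rw [hxe, hye]; field_simp; ring
      rw [this]; positivity
  refine ⟨?_, ?_, rfl⟩
  · rw [hs, hxe, hye]; field_simp; ring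
  · rw [hs]; ring

/-- The resistances `resist a b` are compatible, and they are the only compatible resistances
that start from the `Δ-Y` transform of `(a, b, b)`. -/
theorem isCompatible_iff {a b : ℝ} (hb : 0 < b) (hab : b ≤ a) (x y z : ℕ → ℝ) :
    (IsCompatible x y z ∧ x 0 = a / (a * b + b * b + b * a) ∧
      y 0 = b / (a * b + b * b + b * a) ∧ z 0 = b / (a * b + b * b + b * a)) ↔
    ∀ n, x n = (resist a b n).1 ∧ y n = (resist a b n).2 ∧ z n = (resist a b n).2 := by
  constructor
  · rintro ⟨h, hx0, hy0, hz0⟩ n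
    induction n with
    | zero => exact ⟨hx0, hy0, hz0⟩
    | succ k ih =>
      obtain ⟨p1, p2, p3⟩ := h.pos (k + 1)
      obtain ⟨i1, i2, i3⟩ := ih
      have := step_unique p1 p2 p3 (i1.symm.trans (h.eqx k)) (i2.symm.trans (h.eqy k))
        (i3.symm.trans (h.eqz k))
      exact ⟨this.1, this.2.1, this.2.2.trans this.2.1⟩
  · intro h
    have hs := fun n => step_solves (resist_pos hb hab n).1 (resist_pos hb hab n).2
    refine ⟨⟨fun n => ?_, fun n => ?_, fun n => ?_, fun n => ?_⟩, (h 0).1, (h 0).2.1, (h 0).2.2⟩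
    · rw [(h n).1, (h n).2.1, (h n).2.2]
      have := resist_pos hb hab n
      exact ⟨this.1.trans_le this.2, this.1, this.1⟩
    · rw [(h n).1, (h (n + 1)).1, (h (n + 1)).2.1, (h (n + 1)).2.2]
      exact (hs n).2.2.1
    · rw [(h n).2.1, (h (n + 1)).1, (h (n + 1)).2.1, (h (n + 1)).2.2]
      exact (hs n).2.2.2.1
    · rw [(h n).2.2, (h (n + 1)).1, (h (n + 1)).2.1, (h (n + 1)).2.2]
      exact (hs n).2.2.2.2

/-- The conductance `a_n = x_n / r_n`, `r_n = x_n y_n + y_n z_n + z_n x_n` with `z_n = y_n`, of the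
edge `F_ω(p₂) F_ω(p₃)` of each cell of level `n`. -/
def condA (a b : ℝ) (n : ℕ) : ℝ :=
  (resist a b n).1 / (2 * (resist a b n).1 * (resist a b n).2 + (resist a b n).2 ^ 2)

/-- The conductance `b_n = c_n = y_n / r_n` of the edges `F_ω(p₁) F_ω(p₂)` and `F_ω(p₁) F_ω(p₃)`
of each cell of level `n`. -/
def condB (a b : ℝ) (n : ℕ) : ℝ :=
  (resist a b n).2 / (2 * (resist a b n).1 * (resist a b n).2 + (resist a b n).2 ^ 2)

theorem cond_zero {a b : ℝ} (hb : 0 < b) (hab : b ≤ a) : condA a b 0 = a ∧ condB a b 0 = b := by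
  have ha : 0 < a := hb.trans_le hab
  have hr : a * b + b * b + b * a ≠ 0 := by positivity
  simp only [condA, condB, resist]
  constructor <;> · field_simp; ring

/-! ### The Dirichlet form and the Dirichlet eigenvalues -/

/-- The bilinear form `𝓔_n^{(a,b)}(u, v)` on level `n`; the sum is over the words `ω` of length `n`,
and the quadratic form `𝓔_n^{(a,b)}(u)` is `levelForm a b n u u`. -/
def levelForm (a b : ℝ) (n : ℕ) (u v : C(gasket, ℝ)) : ℝ :=
  ∑ w : Fin n → Fin 3,
    let U := fun i : Fin 3 => u (wordMap n w (bdry i))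
    let V := fun i : Fin 3 => v (wordMap n w (bdry i))
    condB a b n * ((U 0 - U 1) * (V 0 - V 1)) + condB a b n * ((U 0 - U 2) * (V 0 - V 2)) +
      condA a b n * ((U 1 - U 2) * (V 1 - V 2))

/-- `𝓔^{(a,b)}(u, v) = e`, where `𝓔^{(a,b)} = lim 𝓔_n^{(a,b)}`. -/
def HasForm (a b : ℝ) (u v : C(gasket, ℝ)) (e : ℝ) : Prop :=
  Tendsto (fun n => levelForm a b n u v) atTop (𝓝 e)

/-- The domain `𝓕` of the Dirichlet form: the continuous functions of finite energy. -/
def formDomain (a b : ℝ) : Set C(gasket, ℝ) := {u | ∃ e, HasForm a b u u e}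

/-- `𝓕₀ = {u ∈ 𝓕 : u = 0 on V₀}`. -/
def formDomain₀ (a b : ℝ) : Set C(gasket, ℝ) := {u ∈ formDomain a b | ∀ i, u (bdry i) = 0}

/-- `u` is in the domain of `-Δ^{(a,b)}` with the Dirichlet boundary condition and `-Δ^{(a,b)} u = f`.
Here `Δ^{(a,b)}` with the Dirichlet boundary condition is the infinitesimal generator of
the Dirichlet form `(𝓔^{(a,b)}, 𝓕₀)` on `L²(K, μ)`. -/
def IsNegDirichletLaplacian (a b : ℝ) (u : C(gasket, ℝ)) (f : gasket → ℝ) : Prop :=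
  u ∈ formDomain₀ a b ∧ MemLp f 2 mu ∧
    ∀ v ∈ formDomain₀ a b, HasForm a b u v (∫ x, f x * v x ∂mu)

/-- The eigenvalues of `-Δ^{(a,b)}` with the Dirichlet boundary condition. -/
def dirichletEigenvalues (a b : ℝ) : Set ℝ :=
  {l | ∃ u : C(gasket, ℝ), u ≠ 0 ∧ IsNegDirichletLaplacian a b u (fun x => l * u x)}

end SG

end

noncomputable section
namespace SG

/-! ### Barycentric coordinates and the cell structure of the gasket -/

/-! The point is that every estimate depends on `b` only, however large `a / b` is. The vertex `p₁`
is joined to the two others by edges of conductance `b_n`, so oscillation is controlled by those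
edges alone, and `2/3 * b_{n+1} ≥ b_n ≥ 3/5 * b_{n+1}` whatever the ratio `a_n / b_n ≥ 1`
(`Compatible.le_succ`, `Compatible.succ_le`). Chaining through the cells gives a geometric series: a
function of energy at most `E` varies from its value at `p₁` by at most `5 * √(E / b)`
(`abs_sub_bdry_le`). With zero boundary values and `mu` a probability measure, this is a Poincaré
inequality, hence the lower bound for the eigenvalue.

For the upper bound, a test function is harmonic on the three cells of level 1, with boundary values
chosen equal at the two ends of every edge of conductance `a_1`; its energy is `6 * b_1 ≤ 10 * b`
(`exists_test_function`). Its `L²` norm is bounded below because it is `v` on one cell and `1 - v`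
on another.

The smallest eigenvalue is the minimum of the Rayleigh quotient. The oscillation estimate also
yields equicontinuity, so normalized functions of bounded energy form a compact set by
Arzelà–Ascoli, and the energy is a supremum of continuous functionals, hence lower semicontinuous
(`exists_minimizer`). The Euler–Lagrange equation makes the minimizer an eigenfunction
(`isLeast_dirichletEigenvalues`).

That `mu` is a probability measure requires the Hausdorff measure of the gasket to be finite, by the
covering with cells, and positive, by comparison with a Bernoulli measure on addresses. -/

/-- The barycentric coordinates of a point of the plane with respect to the three vertices. -/
def crd (j : Fin 3) (z : ℂ) : ℝ :=
  ![1 - z.re - z.im / √3, z.re - z.im / √3, 2 * z.im / √3] j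

theorem vertex_two : vertex 2 = ⟨1 / 2, √3 / 2⟩ := by
  have h : vertex 2 = Complex.exp ((Real.pi / 3 : ℝ) * Complex.I) := by
    simp only [vertex, Matrix.cons_val]
    congr 1
    push_cast
    ring
  rw [h]
  apply Complex.ext
  · rw [Complex.exp_ofReal_mul_I_re, Real.cos_pi_div_three]
  · rw [Complex.exp_ofReal_mul_I_im, Real.sin_pi_div_three]

theorem crd_vertex (i j : Fin 3) : crd j (vertex i) = if i = j then 1 else 0 := by
  have h3 : √3 ≠ 0 := by positivity
  have h0 : vertex 0 = 0 := rfl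
  have h1 : vertex 1 = 1 := rfl
  fin_cases i <;> fin_cases j <;> simp [crd, h0, h1, vertex_two] <;> field_simp <;> norm_num

theorem crd_sum (z : ℂ) : crd 0 z + crd 1 z + crd 2 z = 1 := by
  simp only [crd, Matrix.cons_val]
  ring

theorem crd_midpoint (j : Fin 3) (z w : ℂ) :
    crd j ((1 / 2 : ℂ) * (z - w) + w) = (crd j z + crd j w) / 2 := by
  have e : ((1 / 2 : ℂ) * (z - w) + w) = ⟨(z.re + w.re) / 2, (z.im + w.im) / 2⟩ := by
    have h : (1 / 2 : ℂ) = ((1 / 2 : ℝ) : ℂ) := by push_cast; rfl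
    rw [h]
    apply Complex.ext
    · simp only [Complex.add_re, Complex.re_ofReal_mul, Complex.sub_re]
      ring
    · simp only [Complex.add_im, Complex.im_ofReal_mul, Complex.sub_im]
      ring
  rw [e]
  fin_cases j <;> simp [crd] <;> ring

theorem crd_ifs (i j : Fin 3) (z : ℂ) :
    crd j (ifs i z) = (crd j z + if i = j then 1 else 0) / 2 := by
  rw [ifs, crd_midpoint, crd_vertex]

theorem crd_ext {z w : ℂ} (h : ∀ j, crd j z = crd j w) : z = w := by
  have h3 : 0 < √3 := by positivity
  have h1 := h 1
  have h2 := h 2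
  simp only [crd, Matrix.cons_val] at h1 h2
  have him : z.im = w.im := by
    field_simp at h2
    linarith
  rw [him] at h1
  exact Complex.ext (by linarith) him

theorem continuous_crd (j : Fin 3) : Continuous (crd j) := by
  unfold crd
  fin_cases j <;> simp only [Fin.zero_eta, Fin.mk_one, Fin.reduceFinMk, Matrix.cons_val] <;>
    fun_prop

theorem abs_crd_sub_le (j : Fin 3) (z w : ℂ) : |crd j z - crd j w| ≤ 2 * dist z w := by
  have hr : |z.re - w.re| ≤ dist z w := by
    rw [Complex.dist_eq, ← Complex.sub_re]
    exact Complex.abs_re_le_norm _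
  have hi : |z.im - w.im| ≤ dist z w := by
    rw [Complex.dist_eq, ← Complex.sub_im]
    exact Complex.abs_im_le_norm _
  have h1 : 1 ≤ √3 := by rw [Real.one_le_sqrt]; norm_num
  have hi' : |(z.im - w.im) / √3| ≤ dist z w := by
    rw [abs_div, abs_of_pos (by positivity : 0 < √3)]
    exact (div_le_self (abs_nonneg _) h1).trans hi
  rw [abs_le] at hr hi' ⊢
  fin_cases j <;>
    simp only [crd, Fin.zero_eta, Fin.mk_one, Fin.reduceFinMk, Matrix.cons_val] <;>
    constructor <;> ring_nf at hr hi' ⊢ <;> linarith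

theorem exists_cell_eq (x : gasket) : ∃ i y, cell i y = x := by
  have h := x.2
  have h' : (x : ℂ) ∈ (gasket : Set ℂ) := h
  rw [gasket_eq] at h'
  obtain ⟨i, y, hy, hyx⟩ := Set.mem_iUnion.1 h'
  exact ⟨i, ⟨y, hy⟩, Subtype.ext hyx⟩

theorem cell_bdry (i : Fin 3) : cell i (bdry i) = bdry i := Subtype.ext (ifs_vertex i)

theorem crd_cell (i j : Fin 3) (x : gasket) :
    crd j (cell i x) = (crd j x + if i = j then 1 else 0) / 2 := crd_ifs i j x

theorem crd_bdry (i j : Fin 3) : crd j (bdry i) = if i = j then 1 else 0 := crd_vertex i j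

instance : CompactSpace gasket := isCompact_iff_compactSpace.1 gasket.isCompact

instance : Nonempty gasket := ⟨bdry 0⟩

theorem continuous_cell (i : Fin 3) : Continuous (cell i) :=
  Continuous.subtype_mk ((continuous_ifs i).comp continuous_subtype_val) _

/-- A minimum `m` of the coordinate over the compact gasket is attained in some cell, where the
coordinate is at least half of a value on the gasket; so `m ≥ m / 2`. -/
theorem crd_nonneg (j : Fin 3) (x : gasket) : 0 ≤ crd j x := by
  have hc : Continuous fun y : gasket => crd j y := (continuous_crd j).comp continuous_subtype_val
  obtain ⟨m, -, hm⟩ := isCompact_univ.exists_isMinOn Set.univ_nonempty hc.continuousOn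
  have hm' : ∀ y : gasket, crd j m ≤ crd j y := fun y => hm (Set.mem_univ y)
  obtain ⟨i, y, hy⟩ := exists_cell_eq m
  have h1 := hm' y
  have h2 := hm' x
  have h3 := crd_cell i j y
  rw [hy] at h3
  split_ifs at h3 <;> linarith

theorem crd_le_one (j : Fin 3) (x : gasket) : crd j x ≤ 1 := by
  have h0 := crd_nonneg 0 x
  have h1 := crd_nonneg 1 x
  have h2 := crd_nonneg 2 x
  have hs := crd_sum x
  fin_cases j <;> simp only [Fin.zero_eta, Fin.mk_one, Fin.reduceFinMk] <;> linarith

theorem eq_bdry_of_crd {j : Fin 3} {x : gasket} (h : 1 ≤ crd j x) : x = bdry j := by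
  have h0 := crd_nonneg 0 x
  have h1 := crd_nonneg 1 x
  have h2 := crd_nonneg 2 x
  have hs := crd_sum x
  apply Subtype.ext
  apply crd_ext
  intro k
  rw [crd_bdry]
  fin_cases j <;> fin_cases k <;> simp at h ⊢ <;> linarith

theorem dist_cell (i : Fin 3) (x y : gasket) : dist (cell i x) (cell i y) = 2⁻¹ * dist x y := by
  have h := edist_ifs i x y
  rw [Subtype.dist_eq, Subtype.dist_eq, dist_edist, dist_edist]
  change (edist (ifs i x) (ifs i y)).toReal = _
  rw [h, ENNReal.toReal_mul]
  simp

theorem antilipschitz_cell (i : Fin 3) : AntilipschitzWith 2 (cell i) :=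
  AntilipschitzWith.of_le_mul_dist fun x y => by rw [dist_cell]; push_cast; linarith

/-- Coordinate `j` is at most `1/2` on cell `i` and at least `1/2` on cell `j`, so at a common point
both bounds are attained. -/
theorem cell_eq_cell {i j : Fin 3} (hij : i ≠ j) {x y : gasket} (h : cell i x = cell j y) :
    x = bdry j ∧ y = bdry i := by
  constructor
  · apply eq_bdry_of_crd
    have h1 := crd_cell i j x
    have h2 := crd_cell j j y
    rw [h, if_neg hij] at h1
    rw [if_pos rfl] at h2
    have := crd_nonneg j y
    linarith
  · apply eq_bdry_of_crd
    have h1 := crd_cell i i x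
    have h2 := crd_cell j i y
    rw [if_neg hij.symm] at h2
    rw [if_pos rfl, h] at h1
    have := crd_nonneg i x
    linarith

theorem cell_bdry_comm (i j : Fin 3) : cell i (bdry j) = cell j (bdry i) := by
  apply Subtype.ext
  apply crd_ext
  intro k
  rw [crd_cell, crd_cell, crd_bdry, crd_bdry, add_comm]

/-- Continuous functions on the three cells that agree at the common points can be glued. -/
theorem exists_glue (g : Fin 3 → C(gasket, ℝ)) (hg : ∀ i j, g i (bdry j) = g j (bdry i)) :
    ∃ G : C(gasket, ℝ), ∀ i x, G (cell i x) = g i x := by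
  let P : C(Fin 3 × gasket, gasket) :=
    ⟨fun p => cell p.1 p.2, continuous_prod_of_discrete_left.2 fun i => continuous_cell i⟩
  -- The disjoint union of three copies of the gasket is compact, so its continuous surjection onto
  -- the Hausdorff gasket is closed, hence a quotient map.
  have hP : IsQuotientMap P := by
    refine P.continuous.isClosedMap.isQuotientMap P.continuous fun x => ?_
    obtain ⟨i, y, h⟩ := exists_cell_eq x
    exact ⟨(i, y), h⟩
  let g' : C(Fin 3 × gasket, ℝ) :=
    ⟨fun p => g p.1 p.2, continuous_prod_of_discrete_left.2 fun i => (g i).continuous⟩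
  have hfac : Function.FactorsThrough g' P := by
    rintro ⟨i, x⟩ ⟨j, y⟩ (h : cell i x = cell j y)
    change g i x = g j y
    by_cases hij : i = j
    · subst hij
      rw [(antilipschitz_cell i).injective h]
    · obtain ⟨rfl, rfl⟩ := cell_eq_cell hij h
      exact hg i j
  refine ⟨hP.lift g' hfac, fun i x => ?_⟩
  have := hP.lift_comp g' hfac
  exact congrArg (fun f : C(Fin 3 × gasket, ℝ) => f (i, x)) this

/-! ### Words -/

theorem wordMap_cons (n : ℕ) (i : Fin 3) (w : Fin n → Fin 3) (x : gasket) :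
    wordMap (n + 1) (Fin.cons i w) x = cell i (wordMap n w x) := by
  simp [wordMap]

theorem exists_wordMap_eq (n : ℕ) (x : gasket) : ∃ w y, wordMap n w y = x := by
  induction n generalizing x with
  | zero => exact ⟨Fin.elim0, x, rfl⟩
  | succ n ih =>
    obtain ⟨i, y, rfl⟩ := exists_cell_eq x
    obtain ⟨w, z, rfl⟩ := ih y
    exact ⟨Fin.cons i w, z, wordMap_cons ..⟩

theorem dist_wordMap (n : ℕ) (w : Fin n → Fin 3) (x y : gasket) :
    dist (wordMap n w x) (wordMap n w y) = 2⁻¹ ^ n * dist x y := by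
  induction n with
  | zero => simp [wordMap]
  | succ n ih => rw [wordMap, wordMap, dist_cell, ih]; ring

theorem continuous_wordMap (n : ℕ) (w : Fin n → Fin 3) : Continuous (wordMap n w) := by
  induction n with
  | zero => exact continuous_id
  | succ n ih => exact (continuous_cell _).comp (ih _)

theorem isClosed_range_wordMap (n : ℕ) (w : Fin n → Fin 3) :
    IsClosed (Set.range (wordMap n w)) :=
  (isCompact_range (continuous_wordMap n w)).isClosed

theorem exists_tendsto_wordMap (x : gasket) :
    ∃ w : (n : ℕ) → Fin n → Fin 3, Tendsto (fun n => wordMap n (w n) (bdry 0)) atTop (𝓝 x) := by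
  choose w y h using fun n => exists_wordMap_eq n x
  refine ⟨w, ?_⟩
  rw [tendsto_iff_dist_tendsto_zero]
  have h0 : Tendsto (fun n : ℕ => (2⁻¹ : ℝ) ^ n * Metric.diam (Set.univ : Set gasket)) atTop
      (𝓝 0) := by
    have := (tendsto_pow_atTop_nhds_zero_of_lt_one (r := (2⁻¹ : ℝ)) (by norm_num)
      (by norm_num)).mul_const (Metric.diam (Set.univ : Set gasket))
    simpa using this
  refine squeeze_zero (fun n => dist_nonneg) (fun n => ?_) h0
  conv_lhs => rw [← h n]
  rw [dist_wordMap]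
  gcongr
  exact Metric.dist_le_diam_of_mem isCompact_univ.isBounded trivial trivial

/-- Near `x`, every point lies in a cell of level `n` that contains `x`. -/
theorem eventually_mem_same_cell (n : ℕ) (x : gasket) :
    ∀ᶠ y in 𝓝 x, ∃ w, x ∈ Set.range (wordMap n w) ∧ y ∈ Set.range (wordMap n w) := by
  have h : ∀ᶠ y in 𝓝 x, ∀ w, x ∉ Set.range (wordMap n w) → y ∉ Set.range (wordMap n w) := by
    rw [eventually_all]
    intro w
    by_cases hx : x ∈ Set.range (wordMap n w)
    · exact Eventually.of_forall fun y h => absurd hx h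
    · filter_upwards [(isClosed_range_wordMap n w).isOpen_compl.mem_nhds hx] with y hy _ using hy
  filter_upwards [h] with y hy
  obtain ⟨w, z, hz⟩ := exists_wordMap_eq n y
  refine ⟨w, ?_, z, hz⟩
  by_contra hx
  exact hy w hx ⟨z, hz⟩

/-! ### The Hausdorff measure of the gasket is positive and finite -/

theorem two_rpow_dim : (2 : ENNReal) ^ (Real.log 3 / Real.log 2) = 3 := by
  have h2 : (2 : ENNReal) = ENNReal.ofReal 2 := by simp
  have h : (2 : ℝ) ^ (Real.log 3 / Real.log 2) = 3 := by
    have : Real.log 2 ≠ 0 := (Real.log_pos (by norm_num)).ne'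
    rw [Real.rpow_def_of_pos (by norm_num), mul_div_cancel₀ _ this, Real.exp_log (by norm_num)]
  rw [h2, ENNReal.ofReal_rpow_of_pos (by norm_num), h]
  simp

theorem dim_nonneg : 0 ≤ Real.log 3 / Real.log 2 := by
  have h2 : 0 < Real.log 2 := Real.log_pos (by norm_num)
  have h3 : 0 < Real.log 3 := Real.log_pos (by norm_num)
  positivity

theorem half_pow_rpow_dim (n : ℕ) :
    ((2 : ENNReal)⁻¹ ^ n) ^ (Real.log 3 / Real.log 2) = 3⁻¹ ^ n := by
  rw [← ENNReal.rpow_natCast, ← ENNReal.rpow_mul, mul_comm, ENNReal.rpow_mul, ENNReal.inv_rpow,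
    two_rpow_dim, ENNReal.rpow_natCast]

theorem ediam_range_wordMap_le (n : ℕ) (w : Fin n → Fin 3) :
    Metric.ediam (Set.range (wordMap n w)) ≤
      2⁻¹ ^ n * Metric.ediam (Set.univ : Set gasket) := by
  refine Metric.ediam_le ?_
  rintro _ ⟨x, rfl⟩ _ ⟨y, rfl⟩
  have h : edist (wordMap n w x) (wordMap n w y) = 2⁻¹ ^ n * edist x y := by
    rw [edist_dist, dist_wordMap, ENNReal.ofReal_mul (by positivity), ← edist_dist,
      ENNReal.ofReal_pow (by positivity), ENNReal.ofReal_inv_of_pos (by norm_num)]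
    simp
  rw [h]
  gcongr
  exact Metric.edist_le_ediam_of_mem trivial trivial

/-- The `3 ^ n` cells of level `n` have diameter at most `2⁻¹ ^ n * D`, and `2 ^ dim = 3`, so each
of these coverings contributes at most `D ^ dim`. -/
theorem hausdorffMeasure_univ_lt_top :
    (μH[Real.log 3 / Real.log 2] : Measure gasket) Set.univ < ⊤ := by
  set D := Metric.ediam (Set.univ : Set gasket) with hD
  have hDtop : D ≠ ⊤ := isCompact_univ.isBounded.ediam_ne_top
  have hr : Tendsto (fun n : ℕ => (2 : ENNReal)⁻¹ ^ n * D) atTop (𝓝 0) := by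
    have h := ENNReal.Tendsto.mul_const (b := D)
      (ENNReal.tendsto_pow_atTop_nhds_zero_of_lt_one (r := 2⁻¹) (by simp)) (Or.inr hDtop)
    simpa using h
  have h := hausdorffMeasure_le_liminf_sum (β := ℕ) (ι := fun n => Fin n → Fin 3)
    (Real.log 3 / Real.log 2) (Set.univ : Set gasket) (l := atTop) _ hr
    (fun n w => Set.range (wordMap n w))
    (Eventually.of_forall fun n w => ediam_range_wordMap_le n w)
    (Eventually.of_forall fun n x _ => by
      obtain ⟨w, y, h⟩ := exists_wordMap_eq n x
      exact Set.mem_iUnion.2 ⟨w, y, h⟩)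
  refine h.trans_lt (lt_of_le_of_lt (b := D ^ (Real.log 3 / Real.log 2)) ?_
    (ENNReal.rpow_lt_top_of_nonneg dim_nonneg hDtop))
  refine liminf_le_of_le (by isBoundedDefault) fun b hb => ?_
  obtain ⟨n, hn⟩ := hb.exists
  refine hn.trans ?_
  calc ∑ w : Fin n → Fin 3, Metric.ediam (Set.range (wordMap n w)) ^ (Real.log 3 / Real.log 2)
      ≤ ∑ w : Fin n → Fin 3, 3⁻¹ ^ n * D ^ (Real.log 3 / Real.log 2) := by
        refine Finset.sum_le_sum fun w _ => ?_
        rw [← half_pow_rpow_dim, ← ENNReal.mul_rpow_of_nonneg _ _ dim_nonneg]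
        exact ENNReal.rpow_le_rpow (ediam_range_wordMap_le n w) dim_nonneg
    _ = D ^ (Real.log 3 / Real.log 2) := by
        rw [Finset.sum_const, Finset.card_univ, Fintype.card_fun, Fintype.card_fin,
          Fintype.card_fin, nsmul_eq_mul, ← mul_assoc]
        push_cast
        rw [← mul_pow, ENNReal.mul_inv_cancel (by norm_num) (by norm_num), one_pow, one_mul]

/-! ### Positivity of the Hausdorff measure: addresses and the Bernoulli measure -/

/-- The shift on infinite words. -/
def shift (o : ℕ → Fin 3) : ℕ → Fin 3 := fun k => o (k + 1)

theorem summable_code (o : ℕ → Fin 3) :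
    Summable fun k => (1 / 2 : ℂ) ^ (k + 1) * vertex (o k) := by
  refine Summable.of_norm_bounded (g := fun k => (1 / 2 : ℝ) ^ (k + 1) * ∑ i, ‖vertex i‖) ?_ ?_
  · exact (((summable_nat_add_iff 1).2 summable_geometric_two)).mul_right _
  · intro k
    rw [norm_mul, norm_pow]
    gcongr
    · simp
    · exact Finset.single_le_sum (f := fun i => ‖vertex i‖) (fun i _ => norm_nonneg _)
        (Finset.mem_univ (o k))

theorem sum_code_mem (n : ℕ) (o : ℕ → Fin 3) :
    ∑ k ∈ Finset.range n, (1 / 2 : ℂ) ^ (k + 1) * vertex (o k) ∈ gasket := by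
  induction n generalizing o with
  | zero => exact vertex_mem_gasket 0
  | succ n ih =>
    have := ifs_mem_gasket (o 0) (ih (shift o))
    convert this using 1
    rw [Finset.sum_range_succ', ifs, mul_sub, Finset.mul_sum]
    have : ∀ k, (1 / 2 : ℂ) ^ (k + 1 + 1) * vertex (o (k + 1)) =
        1 / 2 * ((1 / 2 : ℂ) ^ (k + 1) * vertex (shift o k)) := fun k => by
      rw [shift]; ring
    simp only [this]
    ring

/-- The point of the gasket with a given infinite address. -/
def code (o : ℕ → Fin 3) : gasket :=
  ⟨∑' k, (1 / 2 : ℂ) ^ (k + 1) * vertex (o k),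
    gasket.isCompact.isClosed.mem_of_tendsto (summable_code o).hasSum.tendsto_sum_nat
      (Eventually.of_forall fun n => sum_code_mem n o)⟩

theorem code_eq (o : ℕ → Fin 3) : code o = cell (o 0) (code (shift o)) := by
  apply Subtype.ext
  change ∑' k, (1 / 2 : ℂ) ^ (k + 1) * vertex (o k) =
    ifs (o 0) (∑' k, (1 / 2 : ℂ) ^ (k + 1) * vertex (shift o k))
  rw [(summable_code o).tsum_eq_zero_add, ifs, mul_sub, ← tsum_mul_left]
  have : ∀ k, (1 / 2 : ℂ) ^ (k + 1 + 1) * vertex (o (k + 1)) =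
      1 / 2 * ((1 / 2 : ℂ) ^ (k + 1) * vertex (shift o k)) := fun k => by
    rw [shift]; ring
  simp only [this]
  ring

theorem continuous_code : Continuous code := by
  refine Continuous.subtype_mk ?_ _
  refine continuous_tsum (u := fun k => (1 / 2 : ℝ) ^ (k + 1) * ∑ i, ‖vertex i‖) (fun k => ?_)
    ((((summable_nat_add_iff 1).2 summable_geometric_two)).mul_right _) fun k o => ?_
  · exact continuous_const.mul (continuous_of_discreteTopology.comp (continuous_apply k))
  · rw [norm_mul, norm_pow]
    gcongr
    · simp
    · exact Finset.single_le_sum (f := fun i => ‖vertex i‖) (fun i _ => norm_nonneg _)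
        (Finset.mem_univ (o k))

/-- The integer whose binary digits mark the positions of the letter `j` among the first `n`
letters of an infinite word. -/
def digits (j : Fin 3) (o : ℕ → Fin 3) : ℕ → ℤ
  | 0 => 0
  | n + 1 => 2 * digits j o n + if o n = j then 1 else 0

/-- Scaling by `2 ^ n` splits a coordinate into an integer read off the first `n` letters and the
coordinate of the point addressed by the remaining letters, which lies in `[0, 1]`. -/
theorem crd_code (n : ℕ) (o : ℕ → Fin 3) :
    ∃ y : gasket, ∀ j, crd j (code o) * 2 ^ n = crd j y + digits j o n := by
  suffices ∀ j, crd j (code o) * 2 ^ n = crd j (code (shift^[n] o)) + digits j o n from ⟨_, this⟩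
  intro j
  induction n with
  | zero => simp [digits]
  | succ n ih =>
    have h0 : ∀ n, (shift^[n] o) 0 = o n := by
      intro n
      have : ∀ n k, (shift^[n] o) k = o (k + n) := by
        intro n
        induction n with
        | zero => intro k; rfl
        | succ n ih => intro k; rw [Function.iterate_succ_apply', shift, ih]; congr 1; ring
      rw [this, zero_add]
    have h := crd_cell (o n) j (code (shift^[n + 1] o))
    rw [Function.iterate_succ_apply', ← h0 n, ← code_eq, h0] at h
    rw [Function.iterate_succ_apply', digits]
    rw [h] at ih
    push_cast
    rw [pow_succ, ← mul_assoc, ih]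
    ring

theorem eq_of_digits_eq {n : ℕ} {o o' : ℕ → Fin 3} (h1 : digits 1 o n = digits 1 o' n)
    (h2 : digits 2 o n = digits 2 o' n) : ∀ k < n, o k = o' k := by
  induction n with
  | zero => intro k hk; omega
  | succ n ih =>
    simp only [digits] at h1 h2
    -- Parity reveals whether the last letter is `1` and whether it is `2`; the letter `0` is the
    -- remaining case.
    have hn : o n = o' n := by
      have : ∀ i j : Fin 3, ((i = 1 ↔ j = 1) ∧ (i = 2 ↔ j = 2)) → i = j := by decide
      apply this
      constructor
      · split_ifs at h1 <;> omega
      · split_ifs at h2 <;> omega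
    rw [hn] at h1 h2
    intro k hk
    rcases Nat.lt_succ_iff_lt_or_eq.1 hk with hk | rfl
    · exact ih (by omega) (by omega) k hk
    · exact hn

/-- The coordinates are 2-Lipschitz, so after scaling they differ by at most 2; the fractional parts
account for 1 more. -/
theorem abs_digits_sub_le {n : ℕ} {o o' : ℕ → Fin 3}
    (h : dist (code o) (code o') ≤ 2⁻¹ ^ n) (j : Fin 3) :
    |digits j o n - digits j o' n| ≤ 3 := by
  obtain ⟨y, hy⟩ := crd_code n o
  obtain ⟨y', hy'⟩ := crd_code n o'
  have h1 : |crd j (code o) - crd j (code o')| * 2 ^ n ≤ 2 := by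
    have h2 := abs_crd_sub_le j (code o) (code o')
    rw [← Subtype.dist_eq] at h2
    calc |crd j (code o) - crd j (code o')| * 2 ^ n ≤ (2 * 2⁻¹ ^ n) * 2 ^ n := by
          gcongr
          linarith
      _ = 2 := by rw [mul_assoc, ← mul_pow]; norm_num
  rw [← abs_of_pos (by positivity : (0 : ℝ) < 2 ^ n), ← abs_mul, sub_mul, hy j, hy' j] at h1
  have h3 := crd_nonneg j y
  have h4 := crd_nonneg j y'
  have h5 := crd_le_one j y
  have h6 := crd_le_one j y'
  rw [abs_le] at h1
  have h7 : |((digits j o n - digits j o' n : ℤ) : ℝ)| ≤ (3 : ℤ) := by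
    push_cast
    rw [abs_le]
    constructor <;> linarith
  exact_mod_cast h7

/-- The uniform probability measure on the three letters. -/
def letterMeasure : Measure (Fin 3) := (3 : ENNReal)⁻¹ • Measure.count

instance : IsProbabilityMeasure letterMeasure := by
  constructor
  rw [letterMeasure, Measure.smul_apply, Measure.count_univ]
  simp only [ENat.card_eq_coe_fintype_card, Fintype.card_fin, smul_eq_mul]
  exact ENNReal.inv_mul_cancel (by norm_num) (by norm_num)

/-- The Bernoulli measure on infinite words. -/
def bernoulli : Measure (ℕ → Fin 3) := Measure.infinitePi fun _ => letterMeasure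

instance : IsProbabilityMeasure bernoulli := by unfold bernoulli; infer_instance

theorem bernoulli_cylinder (n : ℕ) (o : ℕ → Fin 3) :
    bernoulli {o' | ∀ k < n, o' k = o k} = 3⁻¹ ^ n := by
  have : {o' | ∀ k < n, o' k = o k} = Set.pi (Finset.range n : Set ℕ) fun k => {o k} := by
    ext o'
    simp
  rw [this, bernoulli, infinitePi_pi _ fun i _ => MeasurableSet.singleton _]
  simp [letterMeasure]

/-- Relative to one address in the preimage, each of the two digit integers takes at most 7 values,
and each pair of values is met by at most one cylinder of mass `3⁻¹ ^ n`; hence `49 = 7 * 7`. -/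
theorem bernoulli_preimage_le {n : ℕ} {s : Set gasket} (hs : Metric.ediam s ≤ 2⁻¹ ^ n) :
    bernoulli (code ⁻¹' s) ≤ 49 * 3⁻¹ ^ n := by
  rcases (code ⁻¹' s).eq_empty_or_nonempty with he | ⟨o, ho⟩
  · simp [he]
  let B : ℤ → Finset ℤ := fun c => Finset.Icc (c - 3) (c + 3)
  let S := B (digits 1 o n) ×ˢ B (digits 2 o n)
  have hsub : code ⁻¹' s ⊆ ⋃ p ∈ S, {o' | digits 1 o' n = p.1 ∧ digits 2 o' n = p.2} := by
    intro o' ho'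
    have hd : dist (code o') (code o) ≤ 2⁻¹ ^ n := by
      have := (Metric.edist_le_ediam_of_mem (s := s) ho' ho).trans hs
      rw [edist_dist, ENNReal.ofReal_le_iff_le_toReal (by simp)] at this
      simpa using this
    have h1 := abs_le.1 (abs_digits_sub_le hd 1)
    have h2 := abs_le.1 (abs_digits_sub_le hd 2)
    simp only [Set.mem_iUnion]
    refine ⟨(digits 1 o' n, digits 2 o' n), ?_, rfl, rfl⟩
    simp only [S, B, Finset.mem_product, Finset.mem_Icc]
    omega
  have hcard : S.card = 49 := by
    simp only [S, B, Finset.card_product, Int.card_Icc]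
    have : ∀ c : ℤ, (c + 3 + 1 - (c - 3)).toNat = 7 := fun c => by
      have : c + 3 + 1 - (c - 3) = 7 := by ring
      rw [this]; rfl
    rw [this, this]
  calc bernoulli (code ⁻¹' s) ≤ _ := measure_mono hsub
    _ ≤ ∑ p ∈ S, bernoulli {o' | digits 1 o' n = p.1 ∧ digits 2 o' n = p.2} :=
        measure_biUnion_finset_le _ _
    _ ≤ ∑ p ∈ S, 3⁻¹ ^ n := by
        refine Finset.sum_le_sum fun p _ => ?_
        rcases {o' : ℕ → Fin 3 | digits 1 o' n = p.1 ∧ digits 2 o' n = p.2}.eq_empty_or_nonempty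
          with he | ⟨q, hq⟩
        · simp [he]
        · rw [← bernoulli_cylinder n q]
          exact measure_mono fun o' ho' =>
            eq_of_digits_eq (ho'.1.trans hq.1.symm) (ho'.2.trans hq.2.symm)
    _ = 49 * 3⁻¹ ^ n := by rw [Finset.sum_const, hcard, nsmul_eq_mul]; norm_cast

/-- This is the mass distribution principle. The constant is `147 = 3 * 49`: rounding the diameter
to a power of `1/2` costs one level, that is, a factor 3. -/
theorem smul_map_bernoulli_le :
    (147 : ENNReal)⁻¹ • bernoulli.map code ≤ (μH[Real.log 3 / Real.log 2] : Measure gasket) := by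
  have hm : Measurable code := continuous_code.measurable
  have key : ∀ {n : ℕ} {s : Set gasket}, Metric.ediam s ≤ 2⁻¹ ^ n →
      bernoulli.map code s ≤ 49 * 3⁻¹ ^ n := by
    intro n s hs
    -- Passing to the closure keeps the diameter and gives a measurable set.
    calc bernoulli.map code s ≤ bernoulli.map code (closure s) := measure_mono subset_closure
      _ = bernoulli (code ⁻¹' closure s) := Measure.map_apply hm isClosed_closure.measurableSet
      _ ≤ _ := bernoulli_preimage_le (by rwa [Metric.ediam_closure])
  refine le_hausdorffMeasure _ _ 1 one_pos fun s hs => ?_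
  rw [Measure.smul_apply, smul_eq_mul]
  rcases eq_or_ne (Metric.ediam s) 0 with h0 | h0
  · have hz : bernoulli.map code s = 0 := by
      have hlim : Tendsto (fun n : ℕ => (49 : ENNReal) * 3⁻¹ ^ n) atTop (𝓝 0) := by
        have h := ENNReal.Tendsto.const_mul (a := 49)
          (ENNReal.tendsto_pow_atTop_nhds_zero_of_lt_one (r := 3⁻¹) (by simp))
          (Or.inr (by norm_num))
        simpa using h
      exact le_antisymm (ge_of_tendsto' hlim fun n => key (by rw [h0]; exact zero_le)) (zero_le)
    rw [hz, mul_zero]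
    exact zero_le
  · have htop : Metric.ediam s ≠ ⊤ := (hs.trans_lt ENNReal.one_lt_top).ne
    obtain ⟨n, hn1, hn2⟩ := exists_nat_pow_near_of_lt_one (x := (Metric.ediam s).toReal)
      (y := (2⁻¹ : ℝ)) (ENNReal.toReal_pos h0 htop)
      (by simpa using ENNReal.toReal_mono ENNReal.one_ne_top hs) (by norm_num) (by norm_num)
    have hp : ∀ m : ℕ, ((2 : ENNReal)⁻¹ ^ m).toReal = 2⁻¹ ^ m := fun m => by simp
    rw [← hp] at hn1 hn2
    have hn1' := ((ENNReal.toReal_lt_toReal (by simp) htop).1 hn1).le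
    have hn2' := (ENNReal.toReal_le_toReal htop (by simp)).1 hn2
    calc (147 : ENNReal)⁻¹ * bernoulli.map code s ≤ 147⁻¹ * (49 * 3⁻¹ ^ n) := by
          gcongr
          exact key hn2'
      _ = 3⁻¹ ^ (n + 1) := by
          have : (147 : ENNReal) = 3 * 49 := by norm_num
          rw [this, ENNReal.mul_inv (by norm_num) (by norm_num), mul_assoc, ← mul_assoc (49⁻¹),
            ENNReal.inv_mul_cancel (by norm_num) (by norm_num), one_mul, pow_succ']
      _ ≤ _ := by
          rw [← half_pow_rpow_dim]
          exact ENNReal.rpow_le_rpow hn1' dim_nonneg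

theorem hausdorffMeasure_univ_ne_zero :
    (μH[Real.log 3 / Real.log 2] : Measure gasket) Set.univ ≠ 0 := by
  have h := smul_map_bernoulli_le Set.univ
  rw [Measure.smul_apply, Measure.map_apply continuous_code.measurable MeasurableSet.univ,
    Set.preimage_univ, measure_univ, smul_eq_mul, mul_one] at h
  exact (lt_of_lt_of_le (by simp) h).ne'

/-! ### The normalized measure and its scaling on cells -/

instance : IsProbabilityMeasure mu := by
  constructor
  rw [mu, Measure.smul_apply, smul_eq_mul]
  exact ENNReal.inv_mul_cancel hausdorffMeasure_univ_ne_zero hausdorffMeasure_univ_lt_top.ne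

/-- The inverse of a cell map is 2-Lipschitz, so it multiplies the Hausdorff measure by at most `2 ^
dim = 3`. This inequality is all the self-similarity of `mu` that is needed. -/
theorem map_cell_mu_le (i : Fin 3) : mu.map (cell i) ≤ (3 : ENNReal) • mu := by
  refine Measure.le_iff.2 fun s hs => ?_
  rw [Measure.map_apply (continuous_cell i).measurable hs]
  have h := (antilipschitz_cell i).hausdorffMeasure_preimage_le dim_nonneg s
  simp only [mu, Measure.smul_apply, smul_eq_mul]
  rw [ENNReal.coe_ofNat, two_rpow_dim] at h
  rw [mul_left_comm]
  gcongr

theorem integral_comp_cell_le (i : Fin 3) {f : C(gasket, ℝ)} (hf : ∀ x, 0 ≤ f x) :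
    ∫ x, f (cell i x) ∂mu ≤ 3 * ∫ x, f x ∂mu := by
  have hint : Integrable f ((3 : ENNReal) • mu) :=
    (f.continuous.integrable_of_hasCompactSupport (HasCompactSupport.of_compactSpace _)).smul_measure
      (by norm_num)
  rw [← integral_map (continuous_cell i).aemeasurable f.continuous.aestronglyMeasurable]
  refine (integral_mono_measure (map_cell_mu_le i) (Eventually.of_forall hf) hint).trans ?_
  rw [integral_smul_measure]
  simp

/-! ### Compatible sequences of conductances -/

/-- Sequences of conductances `(A n, B n, B n)` such that the network of level `n + 1` on the
subdivided triangle is electrically equivalent to that of level `n`. -/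
structure Compatible (A B : ℕ → ℝ) : Prop where
  pos : ∀ n, 0 < B n
  le : ∀ n, B n ≤ A n
  stepB : ∀ n, B n = B (n + 1) * (2 * A (n + 1) + B (n + 1)) / (3 * A (n + 1) + 2 * B (n + 1))
  stepA : ∀ n, A n = B n * (3 * A (n + 1) ^ 2 + 6 * A (n + 1) * B (n + 1) + B (n + 1) ^ 2) /
    (2 * B (n + 1) * (2 * A (n + 1) + 3 * B (n + 1)))

theorem Compatible.tail {A B : ℕ → ℝ} (h : Compatible A B) :
    Compatible (fun n => A (n + 1)) (fun n => B (n + 1)) :=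
  ⟨fun _ => h.pos _, fun _ => h.le _, fun _ => h.stepB _, fun _ => h.stepA _⟩

theorem Compatible.posA {A B : ℕ → ℝ} (h : Compatible A B) (n : ℕ) : 0 < A n :=
  (h.pos n).trans_le (h.le n)

/-- The ratio `(2A + B) / (3A + 2B)` stays below its limit `2/3` as `A / B → ∞`, so the decay is
uniform in `A / B`. -/
theorem Compatible.le_succ {A B : ℕ → ℝ} (h : Compatible A B) (n : ℕ) :
    B n ≤ 2 / 3 * B (n + 1) := by
  have h1 := h.pos (n + 1)
  have h2 := h.posA (n + 1)
  rw [h.stepB n, div_le_iff₀ (by positivity)]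
  nlinarith [mul_pos h1 h1]

/-- The same ratio is smallest, namely `3/5`, when `A = B`; this is where `B ≤ A` enters. -/
theorem Compatible.succ_le {A B : ℕ → ℝ} (h : Compatible A B) (n : ℕ) :
    B (n + 1) ≤ 5 / 3 * B n := by
  have h1 := h.pos (n + 1)
  have h2 := h.posA (n + 1)
  have h3 := h.le (n + 1)
  rw [h.stepB n, mul_div_assoc', le_div_iff₀ (by positivity)]
  nlinarith [mul_le_mul_of_nonneg_left h3 h1.le]

theorem compatible_cond {a b : ℝ} (hb : 0 < b) (hab : b ≤ a) :
    Compatible (condA a b) (condB a b) := by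
  have hp := resist_pos hb hab
  refine ⟨fun n => ?_, fun n => ?_, fun n => ?_, fun n => ?_⟩
  · have := hp n
    have h1 := this.1
    have h2 := h1.trans_le this.2
    unfold condB
    positivity
  · have := hp n
    have h1 := this.1
    have h2 := h1.trans_le this.2
    unfold condA condB
    gcongr
    exact this.2
  all_goals
    obtain ⟨p1, p2⟩ := hp (n + 1)
    obtain ⟨q1, q2⟩ := hp n
    obtain ⟨-, -, e1, e2, -⟩ := step_solves q1 q2
    change (resist a b n).1 =
      (resist a b (n + 1)).1 + phi (resist a b (n + 1)).1 (resist a b (n + 1)).2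
        (resist a b (n + 1)).2 at e1
    change (resist a b n).2 =
      (resist a b (n + 1)).2 + phi (resist a b (n + 1)).2 (resist a b (n + 1)).2
        (resist a b (n + 1)).1 at e2
    simp only [condA, condB]
    generalize (resist a b n).1 = X at *
    generalize (resist a b n).2 = Y at *
    generalize (resist a b (n + 1)).1 = x at *
    generalize (resist a b (n + 1)).2 = y at *
    have hx : 0 < x := p1.trans_le p2
    have hX : 0 < X := q1.trans_le q2
    -- Here `1 / b_n = 2X + Y`, and the compatibility equations turn this sum into `3x + 2y`.
    have hB : Y / (2 * X * Y + Y ^ 2) = 1 / (3 * x + 2 * y) := by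
      have : 3 * x + 2 * y = 2 * X + Y := by
        rw [e1, e2, phi, phi]
        field_simp
        ring
      rw [this]
      field_simp
  · rw [hB]
    field_simp
  · have hA : X / (2 * X * Y + Y ^ 2) = Y / (2 * X * Y + Y ^ 2) * (X / Y) := by field_simp
    rw [hA]
    rw [mul_div_assoc]
    congr 1
    have e1' : X = (3 * x ^ 2 + 6 * x * y + y ^ 2) / (2 * (x + 2 * y)) := by
      rw [e1, phi]
      have : x + y + y = x + 2 * y := by ring
      rw [this]
      field_simp
      ring
    have e2' : Y = y * (2 * x + 3 * y) / (x + 2 * y) := by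
      rw [e2, phi]
      have : y + y + x = x + 2 * y := by ring
      rw [this]
      field_simp
      ring
    rw [e1', e2']
    field_simp

/-! ### The energy of a single cell -/

/-- The bilinear energy of the triangle with conductances `(A, B, B)`. -/
def form (A B : ℝ) (U V : Fin 3 → ℝ) : ℝ :=
  B * ((U 0 - U 1) * (V 0 - V 1)) + B * ((U 0 - U 2) * (V 0 - V 2)) +
    A * ((U 1 - U 2) * (V 1 - V 2))

theorem form_nonneg {A B : ℝ} (hA : 0 ≤ A) (hB : 0 ≤ B) (U : Fin 3 → ℝ) : 0 ≤ form A B U U := by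
  unfold form
  have h1 := mul_self_nonneg (U 0 - U 1)
  have h2 := mul_self_nonneg (U 0 - U 2)
  have h3 := mul_self_nonneg (U 1 - U 2)
  positivity

/-- Only the edges at vertex 0, of conductance `B`, are used; the edge of conductance `A` is
discarded. -/
theorem sq_le_form {A B : ℝ} (hA : 0 ≤ A) (hB : 0 ≤ B) (U : Fin 3 → ℝ) (i : Fin 3) :
    B * (U i - U 0) ^ 2 ≤ form A B U U := by
  unfold form
  have h1 := mul_nonneg hB (mul_self_nonneg (U 0 - U 1))
  have h2 := mul_nonneg hB (mul_self_nonneg (U 0 - U 2))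
  have h3 := mul_nonneg hA (mul_self_nonneg (U 1 - U 2))
  have h0 : 0 ≤ B * (U 0 - U 0) ^ 2 := by simp
  fin_cases i <;> simp only [Fin.zero_eta, Fin.mk_one, Fin.reduceFinMk] <;> nlinarith

/-- The value at the midpoint of the edge between the boundary points `0` and `1` of the harmonic
extension of `U`, for the conductances `(A, B, B)` on the three subcells. -/
def midpoint01 (A B : ℝ) (U : Fin 3 → ℝ) : ℝ :=
  ((2 * U 0 + U 1 + U 2 +
      2 * (((3 * A + B) * (U 1 + U 2) + 2 * B * U 0) / (6 * A + 4 * B))) / 3 +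
    B * (U 1 - U 2) / (2 * A + 3 * B)) / 2

/-- The value of the harmonic extension of `U` at the midpoint between the points `0` and `2`. -/
def midpoint02 (A B : ℝ) (U : Fin 3 → ℝ) : ℝ :=
  ((2 * U 0 + U 1 + U 2 +
      2 * (((3 * A + B) * (U 1 + U 2) + 2 * B * U 0) / (6 * A + 4 * B))) / 3 -
    B * (U 1 - U 2) / (2 * A + 3 * B)) / 2

/-- The value of the harmonic extension of `U` at the midpoint between the points `1` and `2`. -/
def midpoint12 (A B : ℝ) (U : Fin 3 → ℝ) : ℝ :=
  ((3 * A + B) * (U 1 + U 2) + 2 * B * U 0) / (6 * A + 4 * B)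

/-- The boundary values on the subcell `i`, given those on the whole cell and at the midpoints. -/
def subcell (U : Fin 3 → ℝ) (p q r : ℝ) (i : Fin 3) : Fin 3 → ℝ :=
  ![![U 0, p, q], ![p, U 1, r], ![q, r, U 2]] i

/-- Completing the square in the midpoint values: the minimum over them is the energy of the
equivalent coarse triangle, and the excess is the energy of the deviation from the harmonic values.
-/
theorem sum_form_subcell {A B : ℝ} (hA : 0 < A) (hB : 0 < B) (U : Fin 3 → ℝ) (p q r : ℝ) :
    ∑ i, form A B (subcell U p q r i) (subcell U p q r i) =
      form (B * (2 * A + B) / (3 * A + 2 * B) * (3 * A ^ 2 + 6 * A * B + B ^ 2) /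
        (2 * B * (2 * A + 3 * B))) (B * (2 * A + B) / (3 * A + 2 * B)) U U +
      ∑ i, form A B
        (subcell 0 (p - midpoint01 A B U) (q - midpoint02 A B U) (r - midpoint12 A B U) i)
        (subcell 0 (p - midpoint01 A B U) (q - midpoint02 A B U) (r - midpoint12 A B U) i) := by
  rw [Fin.sum_univ_three, Fin.sum_univ_three]
  simp only [form, subcell, midpoint01, midpoint02, midpoint12, Matrix.cons_val, Pi.zero_apply]
  have e : 6 * A + 4 * B = 2 * (3 * A + 2 * B) := by ring
  rw [e]
  field_simp
  ring

/-! ### The energies of the levels -/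

/-- The energy of level `n` for the conductances `(A n, B n, B n)`. -/
def energy (A B : ℕ → ℝ) (n : ℕ) (u : C(gasket, ℝ)) : ℝ :=
  ∑ w : Fin n → Fin 3, form (A n) (B n) (fun i => u (wordMap n w (bdry i)))
    (fun i => u (wordMap n w (bdry i)))

theorem levelForm_self (a b : ℝ) (n : ℕ) (u : C(gasket, ℝ)) :
    levelForm a b n u u = energy (condA a b) (condB a b) n u := rfl

/-- The function `u ∘ F_i`. -/
def compCell (i : Fin 3) (u : C(gasket, ℝ)) : C(gasket, ℝ) := u.comp ⟨cell i, continuous_cell i⟩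

@[simp]
theorem compCell_apply (i : Fin 3) (u : C(gasket, ℝ)) (x : gasket) :
    compCell i u x = u (cell i x) := rfl

theorem energy_zero (A B : ℕ → ℝ) (u : C(gasket, ℝ)) :
    energy A B 0 u = form (A 0) (B 0) (fun i => u (bdry i)) (fun i => u (bdry i)) := by
  simp [energy, wordMap]

theorem energy_succ (A B : ℕ → ℝ) (n : ℕ) (u : C(gasket, ℝ)) :
    energy A B (n + 1) u =
      ∑ i, energy (fun k => A (k + 1)) (fun k => B (k + 1)) n (compCell i u) := by
  unfold energy
  rw [← Fintype.sum_prod_type' (f := fun (i : Fin 3) (w : Fin n → Fin 3) =>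
    form (A (n + 1)) (B (n + 1)) (fun j => compCell i u (wordMap n w (bdry j)))
    (fun j => compCell i u (wordMap n w (bdry j))))]
  refine (Fintype.sum_equiv (Fin.consEquiv fun _ => Fin 3) _ _ fun p => ?_).symm
  simp [Fin.consEquiv, wordMap]

theorem energy_nonneg {A B : ℕ → ℝ} (h : Compatible A B) (n : ℕ) (u : C(gasket, ℝ)) :
    0 ≤ energy A B n u :=
  Finset.sum_nonneg fun _ _ => form_nonneg (h.posA n).le (h.pos n).le _

theorem energy_one (A B : ℕ → ℝ) (u : C(gasket, ℝ)) :
    energy A B 1 u = ∑ i, form (A 1) (B 1) (fun j => u (cell i (bdry j)))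
      (fun j => u (cell i (bdry j))) := by
  rw [energy_succ]
  simp only [energy_zero, compCell_apply, zero_add]

theorem cell_values (u : C(gasket, ℝ)) (i : Fin 3) :
    (fun j => u (cell i (bdry j))) = subcell (fun j => u (bdry j)) (u (cell 0 (bdry 1)))
      (u (cell 0 (bdry 2))) (u (cell 1 (bdry 2))) i := by
  funext j
  fin_cases i <;> fin_cases j <;>
    simp [subcell, cell_bdry, cell_bdry_comm 1 0, cell_bdry_comm 2 0, cell_bdry_comm 2 1]

theorem Compatible.sum_form_subcell {A B : ℕ → ℝ} (h : Compatible A B) (U : Fin 3 → ℝ)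
    (p q r : ℝ) :
    ∑ i, form (A 1) (B 1) (subcell U p q r i) (subcell U p q r i) = form (A 0) (B 0) U U +
      ∑ i, form (A 1) (B 1)
        (subcell 0 (p - midpoint01 (A 1) (B 1) U) (q - midpoint02 (A 1) (B 1) U)
          (r - midpoint12 (A 1) (B 1) U) i)
        (subcell 0 (p - midpoint01 (A 1) (B 1) U) (q - midpoint02 (A 1) (B 1) U)
          (r - midpoint12 (A 1) (B 1) U) i) := by
  rw [SG.sum_form_subcell (h.posA 1) (h.pos 1), h.stepA 0, h.stepB 0]

theorem energy_zero_le_one {A B : ℕ → ℝ} (h : Compatible A B) (u : C(gasket, ℝ)) :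
    energy A B 0 u ≤ energy A B 1 u := by
  rw [energy_zero, energy_one]
  simp only [cell_values]
  rw [h.sum_form_subcell]
  exact le_add_of_nonneg_right
    (Finset.sum_nonneg fun _ _ => form_nonneg (h.posA 1).le (h.pos 1).le _)

theorem energy_mono {A B : ℕ → ℝ} (h : Compatible A B) (u : C(gasket, ℝ)) :
    Monotone fun n => energy A B n u := by
  refine monotone_nat_of_le_succ fun n => ?_
  induction n generalizing A B u with
  | zero => exact energy_zero_le_one h u
  | succ n ih =>
    rw [energy_succ, energy_succ A B (n + 1)]
    exact Finset.sum_le_sum fun i _ => ih h.tail _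

theorem continuous_energy (A B : ℕ → ℝ) (n : ℕ) : Continuous fun u => energy A B n u := by
  have : ∀ x : gasket, Continuous fun u : C(gasket, ℝ) => u x := fun x =>
    continuous_eval_const x
  unfold energy form
  fun_prop

/-! ### Oscillation of functions of finite energy -/

theorem energy_compCell_le {A B : ℕ → ℝ} (h : Compatible A B) (n : ℕ) (u : C(gasket, ℝ))
    (i : Fin 3) :
    energy (fun k => A (k + 1)) (fun k => B (k + 1)) n (compCell i u) ≤ energy A B (n + 1) u := by
  rw [energy_succ]
  exact Finset.single_le_sum
    (f := fun i => energy (fun k => A (k + 1)) (fun k => B (k + 1)) n (compCell i u))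
    (fun i _ => energy_nonneg h.tail n _) (Finset.mem_univ i)

/-- `5/6` is a rational upper bound for `√(2/3)`, as `2/3 = 24/36 ≤ 25/36`. -/
theorem sqrt_div_succ_le {A B : ℕ → ℝ} (h : Compatible A B) {E : ℝ} (hE : 0 ≤ E) :
    √(E / B 1) ≤ 5 / 6 * √(E / B 0) := by
  have h0 := h.pos 0
  have h1 := h.pos 1
  have h2 := h.le_succ 0
  rw [zero_add] at h2
  have : 5 / 6 * √(E / B 0) = √(25 / 36 * (E / B 0)) := by
    rw [Real.sqrt_mul (by norm_num)]
    congr 1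
    rw [eq_comm, Real.sqrt_eq_iff_mul_self_eq_of_pos] <;> norm_num
  rw [this]
  apply Real.sqrt_le_sqrt
  rw [div_le_iff₀ h1]
  have : E = E / B 0 * B 0 := by field_simp
  calc E = E / B 0 * B 0 := this
    _ ≤ E / B 0 * (2 / 3 * B 1) := by gcongr
    _ ≤ 25 / 36 * (E / B 0) * B 1 := by
        have : 0 ≤ E / B 0 * B 1 := by positivity
        linarith

theorem abs_sub_le_of_form {A B : ℝ} (hA : 0 ≤ A) (hB : 0 < B) {E : ℝ} {U : Fin 3 → ℝ}
    (hU : form A B U U ≤ E) (i : Fin 3) : |U i - U 0| ≤ √(E / B) := by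
  apply Real.abs_le_sqrt
  rw [le_div_iff₀ hB, mul_comm]
  exact (sq_le_form hA hB.le U i).trans hU

/-- The constant `5` solves `c = 5/6 * (c + 1)`: one edge of level 1 leads from `p₁` to the corner
of the first subcell, and the induction hypothesis applies inside it. -/
theorem abs_wordMap_sub_le {A B : ℕ → ℝ} (h : Compatible A B) {u : C(gasket, ℝ)} {E : ℝ}
    (hE : ∀ n, energy A B n u ≤ E) (n : ℕ) (w : Fin n → Fin 3) :
    |u (wordMap n w (bdry 0)) - u (bdry 0)| ≤ 5 * √(E / B 0) := by
  induction n generalizing A B u with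
  | zero => simp [wordMap]
  | succ n ih =>
    have hE0 : 0 ≤ E := (energy_nonneg h 0 u).trans (hE 0)
    have h1 := ih h.tail (fun n => (energy_compCell_le h n u (w 0)).trans (hE (n + 1))) (Fin.tail w)
    rw [zero_add, compCell_apply, compCell_apply] at h1
    -- This corner is also vertex `w 0` of cell 0, so a single edge of cell 0 joins it to `p₁`.
    have h2 : |u (cell (w 0) (bdry 0)) - u (bdry 0)| ≤ √(E / B 1) := by
      have h3 := (energy_compCell_le h 0 u 0).trans (hE 1)
      rw [energy_zero] at h3
      have h4 := abs_sub_le_of_form (h.posA 1).le (h.pos 1) h3 (w 0)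
      rwa [compCell_apply, compCell_apply, cell_bdry, cell_bdry_comm] at h4
    have h5 := sqrt_div_succ_le h hE0
    have h6 := abs_sub_le (u (wordMap (n + 1) w (bdry 0))) (u (cell (w 0) (bdry 0))) (u (bdry 0))
    rw [wordMap] at h6 ⊢
    linarith

theorem abs_sub_bdry_le {A B : ℕ → ℝ} (h : Compatible A B) {u : C(gasket, ℝ)} {E : ℝ}
    (hE : ∀ n, energy A B n u ≤ E) (x : gasket) :
    |u x - u (bdry 0)| ≤ 5 * √(E / B 0) := by
  obtain ⟨w, hw⟩ := exists_tendsto_wordMap x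
  exact le_of_tendsto (((u.continuous.tendsto x).comp hw).sub_const _).abs
    (Eventually.of_forall fun n => abs_wordMap_sub_le h hE n (w n))

theorem abs_sub_le_of_mem_cell {A B : ℕ → ℝ} (h : Compatible A B) {u : C(gasket, ℝ)} {E : ℝ}
    (hE : ∀ n, energy A B n u ≤ E) (n : ℕ) (w : Fin n → Fin 3) (x y : gasket) :
    |u (wordMap n w x) - u (wordMap n w y)| ≤ 10 * √(E / B 0) * (5 / 6) ^ n := by
  induction n generalizing A B u with
  | zero =>
    have h1 := abs_sub_bdry_le h hE x
    have h2 := abs_sub_bdry_le h hE y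
    have h3 := abs_sub_le (u x) (u (bdry 0)) (u y)
    rw [abs_sub_comm (u (bdry 0))] at h3
    rw [wordMap, wordMap]
    linarith
  | succ n ih =>
    have hE0 : 0 ≤ E := (energy_nonneg h 0 u).trans (hE 0)
    have h1 := ih h.tail (fun n => (energy_compCell_le h n u (w 0)).trans (hE (n + 1))) (Fin.tail w)
    rw [zero_add, compCell_apply, compCell_apply] at h1
    rw [wordMap, wordMap]
    refine h1.trans ?_
    calc 10 * √(E / B 1) * (5 / 6) ^ n ≤ 10 * (5 / 6 * √(E / B 0)) * (5 / 6) ^ n := by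
          gcongr
          exact sqrt_div_succ_le h hE0
      _ = _ := by ring

/-! ### Harmonic functions -/

/-- The boundary values on the subcell `i` of the harmonic extension of `U`. -/
def harmonicValues (A B : ℝ) (U : Fin 3 → ℝ) (i : Fin 3) : Fin 3 → ℝ :=
  subcell U (midpoint01 A B U) (midpoint02 A B U) (midpoint12 A B U) i

theorem harmonicValues_self (A B : ℝ) (U : Fin 3 → ℝ) (i : Fin 3) :
    harmonicValues A B U i i = U i := by
  fin_cases i <;> rfl

theorem harmonicValues_comm (A B : ℝ) (U : Fin 3 → ℝ) (i j : Fin 3) :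
    harmonicValues A B U i j = harmonicValues A B U j i := by
  fin_cases i <;> fin_cases j <;> rfl

theorem Compatible.sum_form_harmonicValues {A B : ℕ → ℝ} (h : Compatible A B) (U : Fin 3 → ℝ) :
    ∑ i, form (A 1) (B 1) (harmonicValues (A 1) (B 1) U i) (harmonicValues (A 1) (B 1) U i) =
      form (A 0) (B 0) U U := by
  unfold harmonicValues
  rw [h.sum_form_subcell]
  simp only [sub_self, add_eq_left]
  refine Finset.sum_eq_zero fun i _ => ?_
  fin_cases i <;> simp [form, subcell]

theorem Compatible.form_harmonicValues_le {A B : ℕ → ℝ} (h : Compatible A B) (U : Fin 3 → ℝ)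
    (i : Fin 3) :
    form (A 1) (B 1) (harmonicValues (A 1) (B 1) U i) (harmonicValues (A 1) (B 1) U i) ≤
      form (A 0) (B 0) U U := by
  rw [← h.sum_form_harmonicValues]
  exact Finset.single_le_sum (f := fun i => form (A 1) (B 1) (harmonicValues (A 1) (B 1) U i)
    (harmonicValues (A 1) (B 1) U i)) (fun i _ => form_nonneg (h.posA 1).le (h.pos 1).le _)
    (Finset.mem_univ i)

/-- The affine function with boundary values `U`. -/
def affine (U : Fin 3 → ℝ) : C(gasket, ℝ) where
  toFun x := ∑ j, U j * crd j x
  continuous_toFun := by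
    have : ∀ j, Continuous fun x : gasket => crd j x := fun j =>
      (continuous_crd j).comp continuous_subtype_val
    fun_prop

theorem affine_bdry (U : Fin 3 → ℝ) (i : Fin 3) : affine U (bdry i) = U i := by
  simp [affine, crd_bdry]

theorem abs_affine_sub_le {U : Fin 3 → ℝ} {c e : ℝ} (h : ∀ i, |U i - c| ≤ e) (x : gasket) :
    |affine U x - c| ≤ e := by
  have h0 := crd_nonneg 0 x
  have h1 := crd_nonneg 1 x
  have h2 := crd_nonneg 2 x
  have hs := crd_sum x
  have e1 : affine U x - c = (U 0 - c) * crd 0 x + (U 1 - c) * crd 1 x + (U 2 - c) * crd 2 x := by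
    simp only [affine, ContinuousMap.coe_mk, Fin.sum_univ_three]
    linear_combination c * hs
  have e2 : e = e * crd 0 x + e * crd 1 x + e * crd 2 x := by linear_combination -e * hs
  have k0 := abs_le.1 (h 0)
  have k1 := abs_le.1 (h 1)
  have k2 := abs_le.1 (h 2)
  rw [e1, abs_le]
  constructor <;> nlinarith

open Classical in
/-- The function glued from consistent functions on the three cells. -/
def glue (g : Fin 3 → C(gasket, ℝ)) : C(gasket, ℝ) :=
  -- The value 0 is a default only; every family glued below is consistent.
  if h : ∀ i j, g i (bdry j) = g j (bdry i) then (exists_glue g h).choose else 0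

theorem compCell_glue {g : Fin 3 → C(gasket, ℝ)} (hg : ∀ i j, g i (bdry j) = g j (bdry i))
    (i : Fin 3) : compCell i (glue g) = g i := by
  ext x
  rw [glue, dif_pos hg]
  exact (exists_glue g hg).choose_spec i x

/-- Approximations of the harmonic function with boundary values `U`: they are harmonic down to
level `m` and affine on the cells of level `m`. -/
def harmonicApprox : ℕ → (ℕ → ℝ) → (ℕ → ℝ) → (Fin 3 → ℝ) → C(gasket, ℝ)
  | 0, _, _, U => affine U
  | m + 1, A, B, U => glue fun i => harmonicApprox m (fun k => A (k + 1)) (fun k => B (k + 1))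
      (harmonicValues (A 1) (B 1) U i)

theorem harmonicApprox_bdry (m : ℕ) (A B : ℕ → ℝ) (U : Fin 3 → ℝ) (i : Fin 3) :
    harmonicApprox m A B U (bdry i) = U i := by
  induction m generalizing A B U i with
  | zero => exact affine_bdry U i
  | succ m ih =>
    rw [harmonicApprox, ← cell_bdry, ← compCell_apply, compCell_glue, ih, harmonicValues_self]
    intro i j
    rw [ih, ih, harmonicValues_comm]

theorem compCell_harmonicApprox (m : ℕ) (A B : ℕ → ℝ) (U : Fin 3 → ℝ) (i : Fin 3) :
    compCell i (harmonicApprox (m + 1) A B U) =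
      harmonicApprox m (fun k => A (k + 1)) (fun k => B (k + 1))
        (harmonicValues (A 1) (B 1) U i) := by
  rw [harmonicApprox, compCell_glue]
  intro i j
  rw [harmonicApprox_bdry, harmonicApprox_bdry, harmonicValues_comm]

theorem energy_harmonicApprox {A B : ℕ → ℝ} (h : Compatible A B) (U : Fin 3 → ℝ) {n m : ℕ}
    (hnm : n ≤ m) : energy A B n (harmonicApprox m A B U) = form (A 0) (B 0) U U := by
  induction n generalizing A B U m with
  | zero => simp only [energy_zero, harmonicApprox_bdry]
  | succ n ih =>
    obtain ⟨m, rfl⟩ := Nat.exists_eq_succ_of_ne_zero (by omega : m ≠ 0)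
    rw [energy_succ, ← h.sum_form_harmonicValues]
    refine Finset.sum_congr rfl fun i _ => ?_
    rw [Nat.succ_eq_add_one, compCell_harmonicApprox, ih h.tail _ (by omega), zero_add]

theorem abs_harmonicApprox_sub_le {A B : ℕ → ℝ} (h : Compatible A B) (U : Fin 3 → ℝ) (m : ℕ)
    (x : gasket) :
    |harmonicApprox m A B U x - harmonicApprox (m + 1) A B U x| ≤
      5 * √(form (A 0) (B 0) U U / B 0) * (5 / 6) ^ m := by
  induction m generalizing A B U x with
  | zero =>
    obtain ⟨i, x, rfl⟩ := exists_cell_eq x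
    rw [← compCell_apply i (harmonicApprox (0 + 1) A B U), compCell_harmonicApprox]
    simp only [harmonicApprox, pow_zero, mul_one]
    have hE : 0 ≤ form (A 0) (B 0) U U := form_nonneg (h.posA 0).le (h.pos 0).le U
    have hs := sqrt_div_succ_le h hE
    set s := √(form (A 0) (B 0) U U / B 0) with hsdef
    have hs0 : 0 ≤ s := Real.sqrt_nonneg _
    have key : ∀ i j, |harmonicValues (A 1) (B 1) U i j - harmonicValues (A 1) (B 1) U i 0| ≤ s :=
      fun i j => (abs_sub_le_of_form (h.posA 1).le (h.pos 1) (h.form_harmonicValues_le U i) j).trans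
        (by linarith)
    have h1 : |affine U (cell i x) - U 0| ≤ s :=
      abs_affine_sub_le (abs_sub_le_of_form (h.posA 0).le (h.pos 0) le_rfl) _
    -- Any corner of cell `i` is reached from `p₁` by two edges, one in cell 0 and one in cell `i`,
    -- each costing at most `s`.
    have h2 : |affine (harmonicValues (A 1) (B 1) U i) x - U 0| ≤ 2 * s := by
      refine abs_affine_sub_le (fun j => ?_) x
      have k1 := key i j
      have k2 := key 0 i
      rw [harmonicValues_self, harmonicValues_comm] at k2
      have := abs_sub_le (harmonicValues (A 1) (B 1) U i j) (harmonicValues (A 1) (B 1) U i 0) (U 0)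
      linarith
    have h3 := abs_sub_le (affine U (cell i x)) (U 0) (affine (harmonicValues (A 1) (B 1) U i) x)
    rw [abs_sub_comm (U 0)] at h3
    linarith
  | succ m ih =>
    obtain ⟨i, x, rfl⟩ := exists_cell_eq x
    rw [← compCell_apply i, ← compCell_apply i, compCell_harmonicApprox, compCell_harmonicApprox]
    refine (ih h.tail _ x).trans ?_
    simp only [zero_add]
    have hE : 0 ≤ form (A 0) (B 0) U U := form_nonneg (h.posA 0).le (h.pos 0).le U
    calc _ ≤ 5 * √(form (A 0) (B 0) U U / B 1) * (5 / 6) ^ m := by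
          have := h.form_harmonicValues_le U i
          have := h.pos 1
          gcongr
      _ ≤ 5 * (5 / 6 * √(form (A 0) (B 0) U U / B 0)) * (5 / 6) ^ m := by
          gcongr
          exact sqrt_div_succ_le h hE
      _ = _ := by ring

/-- The approximations converge uniformly at a geometric rate, and each level energy involves
finitely many values, so it is constant along the tail and passes to the limit. -/
theorem exists_harmonic {A B : ℕ → ℝ} (h : Compatible A B) (U : Fin 3 → ℝ) :
    ∃ u : C(gasket, ℝ), (∀ i, u (bdry i) = U i) ∧ ∀ n, energy A B n u = form (A 0) (B 0) U U := by
  have hc : CauchySeq fun m => harmonicApprox m A B U := by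
    refine cauchySeq_of_le_geometric (5 / 6) (5 * √(form (A 0) (B 0) U U / B 0)) (by norm_num)
      fun m => ?_
    rw [ContinuousMap.dist_le (by positivity)]
    exact abs_harmonicApprox_sub_le h U m
  obtain ⟨u, hu⟩ := cauchySeq_tendsto_of_complete hc
  refine ⟨u, fun i => ?_, fun n => ?_⟩
  · refine tendsto_nhds_unique (((continuous_eval_const (bdry i)).tendsto u).comp hu) ?_
    exact tendsto_const_nhds.congr fun m => (harmonicApprox_bdry m A B U i).symm
  · refine tendsto_nhds_unique (((continuous_energy A B n).tendsto u).comp hu) ?_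
    refine tendsto_const_nhds.congr' ?_
    filter_upwards [eventually_ge_atTop n] with m hm
    exact (energy_harmonicApprox h U hm).symm

/-! ### A test function -/

theorem energy_one_sub {A B : ℕ → ℝ} (n : ℕ) (u : C(gasket, ℝ)) :
    energy A B n (1 - u) = energy A B n u := by
  unfold energy form
  refine Finset.sum_congr rfl fun w _ => ?_
  simp only [ContinuousMap.sub_apply, ContinuousMap.one_apply]
  ring

/-- There is a function vanishing on the boundary whose energy is comparable to `B 0`, and which is
built from a function `v` and from `1 - v` on two of the cells. -/
theorem exists_test_function {A B : ℕ → ℝ} (h : Compatible A B) :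
    ∃ u v : C(gasket, ℝ), (∀ i, u (bdry i) = 0) ∧ (∀ n, energy A B n u ≤ 10 * B 0) ∧
      compCell 0 u = v ∧ compCell 1 u = 1 - v := by
  -- Equal values at vertices 1 and 2 make the edge of conductance `A 1` contribute nothing, so the
  -- energy is `2 * B 1` on each of three cells, and `6 * B 1 ≤ 10 * B 0`.
  obtain ⟨v, hv, hE⟩ := exists_harmonic h.tail ![0, 1, 1]
  let g : Fin 3 → C(gasket, ℝ) := ![v, 1 - v, 1 - v]
  have hg : ∀ i j, g i (bdry j) = g j (bdry i) := by
    intro i j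
    fin_cases i <;> fin_cases j <;> simp [g, hv]
  refine ⟨glue g, v, fun i => ?_, fun n => ?_, compCell_glue hg 0, compCell_glue hg 1⟩
  · rw [← cell_bdry, ← compCell_apply, compCell_glue hg]
    fin_cases i <;> simp [g, hv]
  · refine (energy_mono h _ (Nat.le_succ n)).trans ?_
    change energy A B (n + 1) _ ≤ _
    have h0 := h.succ_le 0
    rw [energy_succ, Fin.sum_univ_three, compCell_glue hg, compCell_glue hg, compCell_glue hg]
    simp only [g, Matrix.cons_val, energy_one_sub, hE]
    simp only [form, Matrix.cons_val]
    rw [zero_add] at h0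
    linarith

/-! ### Integrals of continuous functions -/

theorem integrable_mu (f : C(gasket, ℝ)) : Integrable f mu :=
  f.continuous.integrable_of_hasCompactSupport (HasCompactSupport.of_compactSpace _)

theorem continuous_integral_mu : Continuous fun f : C(gasket, ℝ) => ∫ x, f x ∂mu := by
  refine (LipschitzWith.of_dist_le_mul (K := 1) fun f g => ?_).continuous
  rw [Real.dist_eq, ← integral_sub (integrable_mu f) (integrable_mu g)]
  have h := norm_integral_le_of_norm_le_const (μ := mu) (f := fun x => f x - g x) (C := dist f g)
    (Eventually.of_forall fun x => by
      rw [← dist_eq_norm]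
      exact ContinuousMap.dist_apply_le_dist x)
  simpa using h

/-- The squared `L²` norm. -/
def sqNorm (u : C(gasket, ℝ)) : ℝ := ∫ x, (u * u) x ∂mu

theorem continuous_sqNorm : Continuous sqNorm :=
  continuous_integral_mu.comp (continuous_id.mul continuous_id)

theorem sqNorm_nonneg (u : C(gasket, ℝ)) : 0 ≤ sqNorm u :=
  integral_nonneg fun x => mul_self_nonneg (u x)

theorem sqNorm_smul (c : ℝ) (u : C(gasket, ℝ)) : sqNorm (c • u) = c ^ 2 * sqNorm u := by
  unfold sqNorm
  rw [← integral_const_mul]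
  refine integral_congr_ae (Eventually.of_forall fun x => ?_)
  simp only [ContinuousMap.mul_apply, ContinuousMap.smul_apply, smul_eq_mul]
  ring

theorem sqNorm_add_smul (t : ℝ) (u v : C(gasket, ℝ)) :
    sqNorm (u + t • v) = sqNorm u + 2 * t * ∫ x, (u * v) x ∂mu + t ^ 2 * sqNorm v := by
  unfold sqNorm
  rw [← integral_const_mul, ← integral_const_mul, ← integral_add, ← integral_add]
  · refine integral_congr_ae (Eventually.of_forall fun x => ?_)
    simp only [ContinuousMap.mul_apply, ContinuousMap.add_apply, ContinuousMap.smul_apply,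
      smul_eq_mul]
    ring
  · exact (integrable_mu _).add ((integrable_mu _).const_mul _)
  · exact (integrable_mu _).const_mul _
  · exact integrable_mu _
  · exact (integrable_mu _).const_mul _

theorem sqNorm_compCell_le (i : Fin 3) (u : C(gasket, ℝ)) : sqNorm (compCell i u) ≤ 3 * sqNorm u :=
  integral_comp_cell_le i (f := u * u) fun x => mul_self_nonneg (u x)

/-- Pointwise `t² + (1 - t)² ≥ 1/2`, so nothing need be known about the size of `v` itself. -/
theorem half_le_sqNorm_add (v : C(gasket, ℝ)) : 1 / 2 ≤ sqNorm v + sqNorm (1 - v) := by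
  unfold sqNorm
  rw [← integral_add (integrable_mu _) (integrable_mu _)]
  have h : ∫ _ : gasket, (1 / 2 : ℝ) ∂mu = 1 / 2 := by simp
  rw [← h]
  refine integral_mono (integrable_const _) ((integrable_mu _).add (integrable_mu _)) fun x => ?_
  simp only [ContinuousMap.mul_apply, ContinuousMap.sub_apply, ContinuousMap.one_apply]
  nlinarith [sq_nonneg (v x - 1 / 2)]

/-! ### The limit form -/

theorem levelForm_add_smul (a b t : ℝ) (n : ℕ) (u v : C(gasket, ℝ)) :
    levelForm a b n (u + t • v) (u + t • v) =
      levelForm a b n u u + 2 * t * levelForm a b n u v + t ^ 2 * levelForm a b n v v := by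
  unfold levelForm
  rw [Finset.mul_sum, Finset.mul_sum, ← Finset.sum_add_distrib, ← Finset.sum_add_distrib]
  refine Finset.sum_congr rfl fun w _ => ?_
  simp only [ContinuousMap.add_apply, ContinuousMap.smul_apply, smul_eq_mul]
  ring

theorem energy_smul (A B : ℕ → ℝ) (n : ℕ) (c : ℝ) (u : C(gasket, ℝ)) :
    energy A B n (c • u) = c ^ 2 * energy A B n u := by
  unfold energy form
  rw [Finset.mul_sum]
  refine Finset.sum_congr rfl fun w _ => ?_
  simp only [ContinuousMap.smul_apply, smul_eq_mul]
  ring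

variable {a b : ℝ}

theorem HasForm.energy_le (hb : 0 < b) (hab : b ≤ a) {u : C(gasket, ℝ)} {e : ℝ}
    (h : HasForm a b u u e) (n : ℕ) : energy (condA a b) (condB a b) n u ≤ e :=
  (energy_mono (compatible_cond hb hab) u).ge_of_tendsto h n

theorem exists_hasForm (hb : 0 < b) (hab : b ≤ a) {u : C(gasket, ℝ)} {R : ℝ}
    (h : ∀ n, energy (condA a b) (condB a b) n u ≤ R) : ∃ e ≤ R, HasForm a b u u e := by
  have hbdd : BddAbove (Set.range fun n => energy (condA a b) (condB a b) n u) :=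
    ⟨R, by rintro _ ⟨n, rfl⟩; exact h n⟩
  exact ⟨_, ciSup_le h, tendsto_atTop_ciSup (energy_mono (compatible_cond hb hab) u) hbdd⟩

theorem HasForm.add_smul {u v : C(gasket, ℝ)} {e f g : ℝ} (hu : HasForm a b u u e)
    (huv : HasForm a b u v g) (hv : HasForm a b v v f) (t : ℝ) :
    HasForm a b (u + t • v) (u + t • v) (e + 2 * t * g + t ^ 2 * f) := by
  unfold HasForm
  simp only [levelForm_add_smul]
  exact (hu.add (huv.const_mul _)).add (hv.const_mul _)

/-- The parallelogram law bounds the energies of `u + v`, which therefore converge; polarization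
gives the mixed limit. -/
theorem exists_hasForm_polar (hb : 0 < b) (hab : b ≤ a) {u v : C(gasket, ℝ)} {e f : ℝ}
    (hu : HasForm a b u u e) (hv : HasForm a b v v f) : ∃ g, HasForm a b u v g := by
  have hbound : ∀ n, energy (condA a b) (condB a b) n (u + (1 : ℝ) • v) ≤ 2 * e + 2 * f := by
    intro n
    have h1 := hu.energy_le hb hab n
    have h2 := hv.energy_le hb hab n
    have h3 := energy_nonneg (compatible_cond hb hab) n (u + (-1 : ℝ) • v)
    rw [← levelForm_self] at h1 h2 h3 ⊢
    rw [levelForm_add_smul] at h3 ⊢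
    linarith
  obtain ⟨k, -, hk⟩ := exists_hasForm hb hab hbound
  refine ⟨(k - e - f) / 2, (((hk.sub hu).sub hv).div_const 2).congr fun n => ?_⟩
  rw [levelForm_add_smul]
  ring

theorem mul_sq_le_energy (hb : 0 < b) (hab : b ≤ a) {u : C(gasket, ℝ)} {e : ℝ}
    (h0 : ∀ i, u (bdry i) = 0) (h : ∀ n, energy (condA a b) (condB a b) n u ≤ e) (x : gasket) :
    b * (u x) ^ 2 ≤ 25 * e := by
  have hc := compatible_cond hb hab
  have h1 := abs_sub_bdry_le hc h x
  have he : 0 ≤ e := (energy_nonneg hc 0 u).trans (h 0)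
  rw [h0, sub_zero, (cond_zero hb hab).2] at h1
  have h2 := pow_le_pow_left₀ (abs_nonneg _) h1 2
  rw [sq_abs, mul_pow, Real.sq_sqrt (by positivity)] at h2
  calc b * u x ^ 2 ≤ b * (5 ^ 2 * (e / b)) := by gcongr
    _ = 25 * e := by field_simp; ring

theorem mul_sqNorm_le_energy (hb : 0 < b) (hab : b ≤ a) {u : C(gasket, ℝ)} {e : ℝ}
    (h0 : ∀ i, u (bdry i) = 0) (h : ∀ n, energy (condA a b) (condB a b) n u ≤ e) :
    b * sqNorm u ≤ 25 * e := by
  have h1 : ∫ _ : gasket, 25 * e ∂mu = 25 * e := by simp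
  rw [sqNorm, ← integral_const_mul, ← h1]
  refine integral_mono ((integrable_mu _).const_mul _) (integrable_const _) fun x => ?_
  have := mul_sq_le_energy hb hab h0 h x
  simp only [ContinuousMap.mul_apply]
  linarith

/-! ### Existence of a minimizer of the Rayleigh quotient -/

/-- The `L²`-normalized functions that vanish on the boundary and have energy at most `R`. -/
def normalizedBall (a b R : ℝ) : Set C(gasket, ℝ) :=
  {u | (∀ i, u (bdry i) = 0) ∧ (∀ n, energy (condA a b) (condB a b) n u ≤ R) ∧ sqNorm u = 1}

theorem isClosed_normalizedBall (a b R : ℝ) : IsClosed (normalizedBall a b R) := by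
  have h : normalizedBall a b R = (⋂ i, {u | u (bdry i) = 0}) ∩
      ((⋂ n, {u | energy (condA a b) (condB a b) n u ≤ R}) ∩ {u | sqNorm u = 1}) := by
    ext u
    simp [normalizedBall]
  rw [h]
  refine (isClosed_iInter fun i => ?_).inter ((isClosed_iInter fun n => ?_).inter ?_)
  · exact isClosed_eq (continuous_eval_const _) continuous_const
  · exact isClosed_le (continuous_energy _ _ n) continuous_const
  · exact isClosed_eq continuous_sqNorm continuous_const

/-- Arzelà–Ascoli: nearby points share a cell of level `n`, where the oscillation is at most a
constant times `(5/6) ^ n`, uniformly over the set. -/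
theorem isCompact_normalizedBall (hb : 0 < b) (hab : b ≤ a) (R : ℝ) :
    IsCompact (normalizedBall a b R) := by
  have hc := compatible_cond hb hab
  let φ := (ContinuousMap.isometryEquivBoundedOfCompact gasket ℝ).toHomeomorph
  rw [← φ.isCompact_image]
  refine BoundedContinuousFunction.arzela_ascoli₂ (Set.Icc (-(5 * √(R / condB a b 0)))
    (5 * √(R / condB a b 0))) isCompact_Icc _ (φ.isClosed_image.2 (isClosed_normalizedBall a b R))
    ?_ ?_
  · rintro _ x ⟨u, hu, rfl⟩
    have := abs_sub_bdry_le hc hu.2.1 x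
    rw [hu.1, sub_zero, abs_le] at this
    exact this
  · intro x
    rw [Metric.equicontinuousAt_iff_right]
    intro ε hε
    have hlim : Tendsto (fun n : ℕ => 10 * √(R / condB a b 0) * (5 / 6) ^ n) atTop (𝓝 0) := by
      have := (tendsto_pow_atTop_nhds_zero_of_lt_one (r := (5 / 6 : ℝ)) (by norm_num)
        (by norm_num)).const_mul (10 * √(R / condB a b 0))
      simpa using this
    obtain ⟨n, hn⟩ := (hlim.eventually (gt_mem_nhds hε)).exists
    filter_upwards [eventually_mem_same_cell n x] with y hy
    rintro ⟨_, u, hu, rfl⟩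
    obtain ⟨w, ⟨x, rfl⟩, ⟨y, rfl⟩⟩ := hy
    exact (abs_sub_le_of_mem_cell hc hu.2.1 n w x y).trans_lt hn

theorem exists_minimizer (hb : 0 < b) (hab : b ≤ a) {R : ℝ}
    (hne : (normalizedBall a b R).Nonempty) :
    ∃ u e, (∀ i, u (bdry i) = 0) ∧ sqNorm u = 1 ∧ HasForm a b u u e ∧ e ≤ R ∧
      ∀ v f, (∀ i, v (bdry i) = 0) → HasForm a b v v f → e * sqNorm v ≤ f := by
  have hc := compatible_cond hb hab
  have hlsc : LowerSemicontinuous fun u : C(gasket, ℝ) =>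
      ⨆ n, ENNReal.ofReal (energy (condA a b) (condB a b) n u) :=
    lowerSemicontinuous_iSup fun n =>
      (ENNReal.continuous_ofReal.comp (continuous_energy _ _ n)).lowerSemicontinuous
  obtain ⟨u, hu, hmin⟩ := (hlsc.lowerSemicontinuousOn _).exists_isMinOn hne
    (isCompact_normalizedBall hb hab R)
  obtain ⟨e, heR, he⟩ := exists_hasForm hb hab hu.2.1
  refine ⟨u, e, hu.1, hu.2.2, he, heR, fun v f hv0 hv => ?_⟩
  have hf : 0 ≤ f := (energy_nonneg hc 0 v).trans (hv.energy_le hb hab 0)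
  rcases (sqNorm_nonneg v).eq_or_lt with h0 | hpos
  · rw [← h0, mul_zero]
    exact hf
  rw [← le_div_iff₀ hpos]
  -- A competitor of quotient above `R` loses trivially because `e ≤ R`; any other can be rescaled
  -- into the compact set.
  by_cases hR : f / sqNorm v ≤ R
  · have hsq : (√(sqNorm v))⁻¹ ^ 2 = (sqNorm v)⁻¹ := by rw [inv_pow, Real.sq_sqrt hpos.le]
    have hE : ∀ n, energy (condA a b) (condB a b) n ((√(sqNorm v))⁻¹ • v) ≤ f / sqNorm v := by
      intro n
      rw [energy_smul, hsq, inv_mul_eq_div]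
      gcongr
      exact hv.energy_le hb hab n
    have hmem : (√(sqNorm v))⁻¹ • v ∈ normalizedBall a b R := by
      refine ⟨fun i => by simp [hv0], fun n => (hE n).trans hR, ?_⟩
      rw [sqNorm_smul, hsq, inv_mul_cancel₀ hpos.ne']
    have hle := hmin hmem
    refine le_of_tendsto' he fun n => ?_
    rw [levelForm_self, ← ENNReal.ofReal_le_ofReal_iff (by positivity)]
    exact (le_iSup (fun n => ENNReal.ofReal (energy (condA a b) (condB a b) n u)) n).trans
      (hle.trans (iSup_le fun n => ENNReal.ofReal_le_ofReal (hE n)))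
  · exact heR.trans (not_le.1 hR).le

theorem normalizedBall_nonempty (hb : 0 < b) (hab : b ≤ a) :
    (normalizedBall a b (120 * b)).Nonempty := by
  have hc := compatible_cond hb hab
  obtain ⟨u, v, hu0, hE, h0, h1⟩ := exists_test_function hc
  have k0 := sqNorm_compCell_le 0 u
  have k1 := sqNorm_compCell_le 1 u
  rw [h0] at k0
  rw [h1] at k1
  -- Each of the two cells contributes at most `3 * sqNorm u`, so `1/2 ≤ 6 * sqNorm u`; then `10 * b
  -- / (1/12) = 120 * b`.
  have hs : 1 / 12 ≤ sqNorm u := by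
    have := half_le_sqNorm_add v
    linarith
  have hpos : 0 < sqNorm u := by linarith
  have hsq : (√(sqNorm u))⁻¹ ^ 2 = (sqNorm u)⁻¹ := by rw [inv_pow, Real.sq_sqrt hpos.le]
  refine ⟨(√(sqNorm u))⁻¹ • u, fun i => by simp [hu0], fun n => ?_, ?_⟩
  · have := hE n
    rw [(cond_zero hb hab).2] at this
    rw [energy_smul, hsq, inv_mul_eq_div, div_le_iff₀ hpos]
    nlinarith
  · rw [sqNorm_smul, hsq, inv_mul_cancel₀ hpos.ne']

/-- A minimizer of the Rayleigh quotient satisfies the Euler-Lagrange equation. -/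
theorem hasForm_of_minimizer (hb : 0 < b) (hab : b ≤ a) {u v : C(gasket, ℝ)} {e f : ℝ}
    (hu0 : ∀ i, u (bdry i) = 0) (hu : HasForm a b u u e) (hu1 : sqNorm u = 1)
    (hmin : ∀ v f, (∀ i, v (bdry i) = 0) → HasForm a b v v f → e * sqNorm v ≤ f)
    (hv0 : ∀ i, v (bdry i) = 0) (hv : HasForm a b v v f) :
    HasForm a b u v (e * ∫ x, (u * v) x ∂mu) := by
  obtain ⟨g, hg⟩ := exists_hasForm_polar hb hab hu hv
  suffices g = e * ∫ x, (u * v) x ∂mu from this ▸ hg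
  have key : ∀ t : ℝ, 0 ≤ (f - e * sqNorm v) * (t * t) +
      2 * (g - e * ∫ x, (u * v) x ∂mu) * t + 0 := by
    intro t
    have h := hmin (u + t • v) _ (fun i => by simp [hu0, hv0]) (hu.add_smul hg hv t)
    rw [sqNorm_add_smul, hu1] at h
    linarith
  -- A nonnegative quadratic polynomial without constant term has no linear term.
  have hd := discrim_le_zero key
  rw [discrim] at hd
  have h2 : (g - e * ∫ x, (u * v) x ∂mu) ^ 2 = 0 :=
    le_antisymm (by linarith) (sq_nonneg _)
  linarith [pow_eq_zero_iff (two_ne_zero) |>.1 h2]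

theorem memLp_mu (u : C(gasket, ℝ)) : MemLp u 2 mu :=
  MemLp.of_bound u.continuous.aestronglyMeasurable ‖u‖
    (Eventually.of_forall fun x => u.norm_coe_le_norm x)

theorem isLeast_dirichletEigenvalues (hb : 0 < b) (hab : b ≤ a) {u : C(gasket, ℝ)} {e : ℝ}
    (hu0 : ∀ i, u (bdry i) = 0) (hu : HasForm a b u u e) (hu1 : sqNorm u = 1)
    (hmin : ∀ v f, (∀ i, v (bdry i) = 0) → HasForm a b v v f → e * sqNorm v ≤ f) :
    IsLeast (dirichletEigenvalues a b) e := by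
  constructor
  · refine ⟨u, ?_, ⟨⟨e, hu⟩, hu0⟩, (memLp_mu u).const_mul e, ?_⟩
    · rintro rfl
      simp [sqNorm] at hu1
    · rintro v ⟨⟨f, hv⟩, hv0⟩
      have h := hasForm_of_minimizer hb hab hu0 hu hu1 hmin hv0 hv
      rw [← integral_const_mul] at h
      simpa only [ContinuousMap.mul_apply, mul_assoc] using h
  · rintro l ⟨v, hv, hvF, -, h⟩
    have hvl : HasForm a b v v (l * sqNorm v) := by
      have := h v hvF
      simp only [mul_assoc] at this
      rwa [integral_const_mul] at this
    -- If the `L²` norm of the eigenfunction vanished, so would its energy, and the pointwise bound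
    -- would force `v = 0`; this needs nothing about the support of `mu`.
    rcases (sqNorm_nonneg v).eq_or_lt with h0 | hpos
    · refine absurd (ContinuousMap.ext fun x => ?_) hv
      rw [← h0, mul_zero] at hvl
      have := mul_sq_le_energy hb hab hvF.2 (hvl.energy_le hb hab) x
      rw [mul_zero] at this
      exact pow_eq_zero_iff two_ne_zero |>.1
        (le_antisymm (nonpos_of_mul_nonpos_right this hb) (sq_nonneg _))
    · exact le_of_mul_le_mul_right (hmin v _ hvF.2 hvl) hpos

end SG
end

theorem lemma3p3 :
    ∃ C : ℝ, 0 < C ∧ ∀ a b : ℝ, 0 < b → b < a →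
      ∃ lambda₁ : ℝ, IsLeast (SG.dirichletEigenvalues a b) lambda₁ ∧
        C⁻¹ * b ≤ lambda₁ ∧ lambda₁ ≤ C * b := by
  -- The upper bound dictates 120; the lower bound holds even with `1/25`.
  refine ⟨120, by norm_num, fun a b hb hab => ?_⟩
  obtain ⟨u, e, hu0, hu1, hu, heR, hmin⟩ :=
    SG.exists_minimizer hb hab.le (SG.normalizedBall_nonempty hb hab.le)
  refine ⟨e, SG.isLeast_dirichletEigenvalues hb hab.le hu0 hu hu1 hmin, ?_, heR⟩
  have h := SG.mul_sqNorm_le_energy hb hab.le hu0 (hu.energy_le hb hab.le)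
  rw [hu1] at h
  linarith
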